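/- Throughout, the space domain is $(-1,1)$. There are absolute constants $\alpha,C_1,C_2>0$ (in particular independent of $\varepsilon$) with the following property. Let $m_0>0$, $\phi_0(1)=-\phi_0(-1)>0$, $\varepsilon>0$ and $0<\gamma_\varepsilon\le\gamma_{max}<\infty$. Let $\psi$ be the solution of the charge-conserving Poisson–Boltzmann equation $$\varepsilon\psi_{xx}=n^0-p^0\ \text{ in }(-1,1),\qquad n^0=\frac{m_0e^{\psi}}{\int_{-1}^1e^{\psi}dx},\quad p^0=\frac{m_0e^{-\psi}}{\int_{-1}^1e^{-\psi}dx},\qquad \psi(\pm1)\pm\gamma_\varepsilon\psi_x(\pm1)=\phi_0(\pm1),$$ and put $\delta^0=n^0-p^0$, $\eta^0=n^0+p^0$. Let $(\tilde\delta,\tilde\eta,\tilde\phi)$ be a classical solution, for $x\in(-1,1)$ and $t>0$, of the linearized problem $$\tilde\delta_t=\tilde\delta_{xx}-(\eta^0\tilde\phi_x)_x-(\tilde\eta\psi_x)_x,\qquad \tilde\eta_t=\tilde\eta_{xx}-(\delta^0\tilde\phi_x)_x-(\tilde\delta\psi_x)_x,\qquad \varepsilon\tilde\phi_{xx}=\tilde\delta,$$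 with the boundary conditions, at $x=\pm1$, $$\tilde\delta_x-\eta^0\tilde\phi_x-\tilde\eta\psi_x=0,\qquad \tilde\eta_x-\delta^0\tilde\phi_x-\tilde\delta\psi_x=0,\qquad \tilde\phi\pm\gamma_\varepsilon\tilde\phi_x=0,$$ and with integrable initial data, attained in $L^1(-1,1)$ as $t\to0^+$, such that $\int_{-1}^1\tilde\delta(x,0)\,dx=\int_{-1}^1\tilde\eta(x,0)\,dx=0$. Assume $$\frac{\gamma_\varepsilon}{\sqrt\varepsilon}>\frac{\left((1+2\gamma_{max})^2+3\right)K_0\,\phi_0(1)}{4M},\qquad M=\sqrt{\frac{m_0}{2e^{\phi_0(1)}}},\qquad K_0=\sup_{0<|y|\le\phi_0(1)}\frac{|e^y-1|}{|y|}.$$ Let $D(x,t)=\int_{-1}^x\tilde\delta(s,t)\,ds$, $H(x,t)=\int_{-1}^x\tilde\eta(s,t)\,ds$, $d=\frac12\int_{-1}^1D\,dx$, $h=\frac12\int_{-1}^1H\,dx$, $\bar D=D-d$, $\bar H=H-h$, $\tilde n=\frac12(\tilde\delta+\tilde\eta)$, $\tilde p=\frac12(\tilde\eta-\tilde\delta)$,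 and $$I_0=\Big[\tfrac12\int_{-1}^1(\bar D^2+\bar H^2)\,dx+d^2+h^2\Big]_{t=0}.$$ Then, for all $t>0$, $$\frac12\int_{-1}^1(\bar D^2+\bar H^2)\,dx+d^2+h^2\le I_0e^{-\alpha t},\qquad \|D\|_{L^2}^2+\|H\|_{L^2}^2\le 2I_0e^{-\alpha t},\qquad \|\tilde n\|_{H^{-1}}^2+\|\tilde p\|_{H^{-1}}^2\le I_0e^{-\alpha t},$$ and, for all $t\ge0$, $$C_1\big(\|D\|_{L^2}+\|H\|_{L^2}\big)\le\|\tilde n\|_{H^{-1}}+\|\tilde p\|_{H^{-1}}\le C_2\big(\|D\|_{L^2}+\|H\|_{L^2}\big),$$ where $\|f\|_{H^{-1}}=\sup\{\int_{-1}^1fv\,dx:\ v\in H^1(-1,1),\ \|v\|_{L^2}^2+\|v_x\|_{L^2}^2=1\}$. -/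

import Mathlib

open Set Filter Topology MeasureTheory

noncomputable section

namespace PNP

/-! Space is the interval `(-1, 1)`. A space-time function `u : ℝ → ℝ → ℝ` is written with the
time first, so that `u t` is the spatial profile at time `t` and `u t x` its value at `x`. -/

/-- Spatial derivative on `[-1, 1]`: the usual derivative in the interior, the one-sided
derivative at `±1`. -/
def dx (f : ℝ → ℝ) : ℝ → ℝ := derivWithin f (Icc (-1) 1)

/-- `m₀ e^ψ / ∫ e^ψ`. -/
def nSteady (m₀ : ℝ) (ψ : ℝ → ℝ) (x : ℝ) : ℝ :=
  m₀ * Real.exp (ψ x) / ∫ y in (-1 : ℝ)..1, Real.exp (ψ y)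

/-- `m₀ e^{-ψ} / ∫ e^{-ψ}`. -/
def pSteady (m₀ : ℝ) (ψ : ℝ → ℝ) (x : ℝ) : ℝ :=
  m₀ * Real.exp (-ψ x) / ∫ y in (-1 : ℝ)..1, Real.exp (-ψ y)

/-- `δ⁰ = n⁰ - p⁰`. -/
def deltaSteady (m₀ : ℝ) (ψ : ℝ → ℝ) (x : ℝ) : ℝ := nSteady m₀ ψ x - pSteady m₀ ψ x

/-- `η⁰ = n⁰ + p⁰`. -/
def etaSteady (m₀ : ℝ) (ψ : ℝ → ℝ) (x : ℝ) : ℝ := nSteady m₀ ψ x + pSteady m₀ ψ x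

/-- `f ∈ C¹([-1, 1]) ∩ C²((-1, 1))`. -/
def IsC1C2 (f : ℝ → ℝ) : Prop :=
  ContDiffOn ℝ 1 f (Icc (-1) 1) ∧ ContDiffOn ℝ 2 f (Ioo (-1) 1)

/-- `ψ` solves the charge-conserving Poisson–Boltzmann equation with Robin boundary data
`φ₀(1) = φb`, `φ₀(-1) = -φb`. -/
structure IsBoundaryLayer (ε γ m₀ φb : ℝ) (ψ : ℝ → ℝ) : Prop where
  regular : IsC1C2 ψ
  poisson : ∀ x ∈ Ioo (-1 : ℝ) 1, ε * dx (dx ψ) x = nSteady m₀ ψ x - pSteady m₀ ψ x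
  robin_right : ψ 1 + γ * dx ψ 1 = φb
  robin_left : ψ (-1) - γ * dx ψ (-1) = -φb

/-- Regularity of a classical solution of a parabolic equation with a flux boundary condition:
`u, u_x` are continuous on `(0, ∞) × [-1, 1]`, and `u_xx, u_t` are continuous on
`(0, ∞) × (-1, 1)`. -/
structure IsParabolicRegular (u : ℝ → ℝ → ℝ) : Prop where
  cont : ContinuousOn (fun q : ℝ × ℝ => u q.1 q.2) (Ioi 0 ×ˢ Icc (-1) 1)
  diff_x : ∀ t > 0, DifferentiableOn ℝ (u t) (Icc (-1) 1)
  cont_x : ContinuousOn (fun q : ℝ × ℝ => dx (u q.1) q.2) (Ioi 0 ×ˢ Icc (-1) 1)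
  diff_xx : ∀ t > 0, DifferentiableOn ℝ (dx (u t)) (Ioo (-1) 1)
  cont_xx : ContinuousOn (fun q : ℝ × ℝ => dx (dx (u q.1)) q.2) (Ioi 0 ×ˢ Ioo (-1) 1)
  diff_t : ∀ x ∈ Ioo (-1 : ℝ) 1, DifferentiableOn ℝ (fun t => u t x) (Ioi 0)
  cont_t : ContinuousOn (fun q : ℝ × ℝ => deriv (fun t => u t q.2) q.1) (Ioi 0 ×ˢ Ioo (-1) 1)

/-- The initial datum `u 0` is integrable on `(-1, 1)` and is attained in `L¹(-1, 1)`. -/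
def AttainsInitialData (u : ℝ → ℝ → ℝ) : Prop :=
  IntervalIntegrable (u 0) volume (-1) 1 ∧
    Tendsto (fun t => ∫ x in (-1 : ℝ)..1, |u t x - u 0 x|) (𝓝[>] 0) (𝓝 0)

/-- `(δ, η, φ)` is a classical solution of the linearized perturbation problem around the
boundary layer `ψ`, with no-flux conditions for `δ, η` and a Robin condition for `φ`. -/
structure IsLinearizedSolution (ε γ m₀ : ℝ) (ψ : ℝ → ℝ) (δ η φ : ℝ → ℝ → ℝ) : Prop where
  regular_delta : IsParabolicRegular δ
  regular_eta : IsParabolicRegular η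
  regular_phi : ∀ t > 0, IsC1C2 (φ t)
  initial_delta : AttainsInitialData δ
  initial_eta : AttainsInitialData η
  eq_delta : ∀ t > 0, ∀ x ∈ Ioo (-1 : ℝ) 1,
    deriv (fun s => δ s x) t = dx (dx (δ t)) x
      - dx (fun y => etaSteady m₀ ψ y * dx (φ t) y) x - dx (fun y => η t y * dx ψ y) x
  eq_eta : ∀ t > 0, ∀ x ∈ Ioo (-1 : ℝ) 1,
    deriv (fun s => η s x) t = dx (dx (η t)) x
      - dx (fun y => deltaSteady m₀ ψ y * dx (φ t) y) x - dx (fun y => δ t y * dx ψ y) x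
  eq_phi : ∀ t > 0, ∀ x ∈ Ioo (-1 : ℝ) 1, ε * dx (dx (φ t)) x = δ t x
  noflux_delta : ∀ t > 0, ∀ x ∈ ({-1, 1} : Set ℝ),
    dx (δ t) x - etaSteady m₀ ψ x * dx (φ t) x - η t x * dx ψ x = 0
  noflux_eta : ∀ t > 0, ∀ x ∈ ({-1, 1} : Set ℝ),
    dx (η t) x - deltaSteady m₀ ψ x * dx (φ t) x - δ t x * dx ψ x = 0
  robin_right : ∀ t > 0, φ t 1 + γ * dx (φ t) 1 = 0
  robin_left : ∀ t > 0, φ t (-1) - γ * dx (φ t) (-1) = 0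

/-- `x ↦ ∫_{-1}^x u(s, t) ds`; this is `D` for `u = δ` and `H` for `u = η`. -/
def prim (u : ℝ → ℝ → ℝ) (t x : ℝ) : ℝ := ∫ s in (-1 : ℝ)..x, u t s

/-- Mean value on `(-1, 1)`; `d(t)` and `h(t)` are the means of `D` and `H`. -/
def mean (f : ℝ → ℝ) : ℝ := (1 / 2) * ∫ x in (-1 : ℝ)..1, f x

/-- `f - mean f`; `D̄` and `H̄` are obtained so from `D` and `H`. -/
def fluct (f : ℝ → ℝ) (x : ℝ) : ℝ := f x - mean f

/-- `½ ∫ (D̄² + H̄²) dx + d² + h²` at time `t`. -/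
def energy (δ η : ℝ → ℝ → ℝ) (t : ℝ) : ℝ :=
  (1 / 2) * (∫ x in (-1 : ℝ)..1, ((fluct (prim δ t) x) ^ 2 + (fluct (prim η t) x) ^ 2))
    + (mean (prim δ t)) ^ 2 + (mean (prim η t)) ^ 2

/-- `L²(-1, 1)` norm. -/
def l2Norm (f : ℝ → ℝ) : ℝ := Real.sqrt (∫ x in (-1 : ℝ)..1, (f x) ^ 2)

/-- `v ∈ H¹(-1, 1)` with weak derivative `w`. -/
structure IsH1 (v w : ℝ → ℝ) : Prop where
  memLp : MemLp v 2 (volume.restrict (Ioo (-1) 1))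
  memLp_deriv : MemLp w 2 (volume.restrict (Ioo (-1) 1))
  weak : ∀ ζ : ℝ → ℝ, ContDiff ℝ ((⊤ : ℕ∞) : WithTop ℕ∞) ζ → HasCompactSupport ζ →
    tsupport ζ ⊆ Ioo (-1) 1 →
    ∫ x in (-1 : ℝ)..1, v x * deriv ζ x = - ∫ x in (-1 : ℝ)..1, w x * ζ x

/-- Norm in the dual of `H¹(-1, 1)`: the supremum of `∫ f v` over `v ∈ H¹(-1, 1)` with
`‖v‖_{L²}² + ‖v_x‖_{L²}² = 1`. -/
def hMinusOneNorm (f : ℝ → ℝ) : ℝ :=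
  sSup {r : ℝ | ∃ v w : ℝ → ℝ, IsH1 v w ∧ (l2Norm v) ^ 2 + (l2Norm w) ^ 2 = 1 ∧
    r = ∫ x in (-1 : ℝ)..1, f x * v x}

/-- `ñ = (δ + η) / 2` at time `t`. -/
def nTilde (δ η : ℝ → ℝ → ℝ) (t x : ℝ) : ℝ := (δ t x + η t x) / 2

/-- `p̃ = (η - δ) / 2` at time `t`. -/
def pTilde (δ η : ℝ → ℝ → ℝ) (t x : ℝ) : ℝ := (η t x - δ t x) / 2

/-- `M = √(m₀ / (2 e^{φ₀(1)}))`. -/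
def constM (m₀ φb : ℝ) : ℝ := Real.sqrt (m₀ / (2 * Real.exp φb))

/-- `K₀ = sup_{0 < |y| ≤ φ₀(1)} |e^y - 1| / |y|`. -/
def constK (φb : ℝ) : ℝ :=
  sSup ((fun y : ℝ => |Real.exp y - 1| / |y|) '' {y : ℝ | 0 < |y| ∧ |y| ≤ φb})

end PNP

end

/-!
`D` and `H` vanish at `±1` and their time derivatives are the two fluxes; moreover
`energy δ η = ½ ∫ (D² + H²)`. Integrating the equation for the potential gives `ε φ_x = D - k`,
where the Robin condition fixes the constant through `d = (1 + γ) k`. Integrating by parts, the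
energy decreases at the rate

  `∫ (D_x² + H_x² + k H_x ψ_x + η⁰ D (D - k) / ε)`.

Let `κ ≥ 2 M²` be the minimum of `η⁰`; the bound holds because `ψ` is increasing with total increase
at most `2 φ₀(1)`. The good term is `(κ / ε) ∫ D (D - k) ≥ 2 γ (1 + γ) κ k² / ε`. The terms without
a sign are at least `-½ ∫ H_x² - (5 / 8) k² ∫ ψ_x²`, since the first integral of the
Poisson–Boltzmann equation gives `η⁰ - κ ≤ ε ψ_x² / 2`. Testing that equation with `ψ` yields
`∫ ψ_x² ≤ φ₀(1)² / (2 γ)`, so the good term wins as soon as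
`5 ε φ₀(1)² ≤ 64 M² γ² (1 + γ)`, and Poincaré's inequality turns the remaining dissipation into
exponential decay.

For the dual norm, `∫ f v = -∫ F v_x` when `f` has mean zero and primitive `F`: this bounds the norm
of `f` by `‖F‖`, and choosing `v_x = -F` bounds `‖F‖` by a multiple of the norm of `f`.
-/

namespace PNP

/-! ### Calculus on an interval -/

section Calculus

variable {a b : ℝ}

theorem eq_left_of_hasDerivAt_zero {f : ℝ → ℝ} (hf : ContinuousOn f (Icc a b))
    (hd : ∀ x ∈ Ioo a b, HasDerivAt f 0 x) {x : ℝ} (hx : x ∈ Icc a b) : f x = f a := by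
  have h := intervalIntegral.integral_eq_sub_of_hasDerivAt_of_le hx.1
    (hf.mono (Icc_subset_Icc_right hx.2)) (fun y hy => hd y ⟨hy.1, hy.2.trans_le hx.2⟩)
    intervalIntegrable_const
  simpa [eq_comm, sub_eq_zero] using h

theorem integral_mul_deriv_eq_of_continuousOn (hab : a ≤ b) {u v u' v' : ℝ → ℝ}
    (hu : ContinuousOn u (Icc a b)) (hv : ContinuousOn v (Icc a b))
    (hu' : ContinuousOn u' (Icc a b)) (hv' : ContinuousOn v' (Icc a b))
    (hdu : ∀ x ∈ Ioo a b, HasDerivAt u (u' x) x) (hdv : ∀ x ∈ Ioo a b, HasDerivAt v (v' x) x) :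
    ∫ x in a..b, u x * v' x = u b * v b - u a * v a - ∫ x in a..b, u' x * v x := by
  apply intervalIntegral.integral_mul_deriv_eq_deriv_mul_of_hasDerivAt
  all_goals first
    | rwa [uIcc_of_le hab]
    | rwa [min_eq_left hab, max_eq_right hab]
    | exact ContinuousOn.intervalIntegrable_of_Icc hab ‹_›

theorem continuousOn_primitive (hab : a ≤ b) {f : ℝ → ℝ} (hf : IntervalIntegrable f volume a b) :
    ContinuousOn (fun x => ∫ s in a..x, f s) (Icc a b) := by
  simpa only [uIcc_of_le hab] using
    intervalIntegral.continuousOn_primitive_interval' hf left_mem_uIcc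

theorem intervalIntegrable_of_mem_Icc {f : ℝ → ℝ} (hf : IntervalIntegrable f volume a b) {x : ℝ}
    (hx : x ∈ Icc a b) : IntervalIntegrable f volume a x :=
  hf.mono_set (by
    rw [uIcc_of_le hx.1, uIcc_of_le (hx.1.trans hx.2)]; exact Icc_subset_Icc_right hx.2)

theorem hasDerivAt_primitive {f : ℝ → ℝ} (hf : ContinuousOn f (Icc a b)) {x : ℝ}
    (hx : x ∈ Ioo a b) : HasDerivAt (fun x => ∫ s in a..x, f s) (f x) x :=
  intervalIntegral.integral_hasDerivAt_right
    (intervalIntegrable_of_mem_Icc (hf.intervalIntegrable_of_Icc (hx.1.trans hx.2).le)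
      (Ioo_subset_Icc_self hx))
    ((hf.mono Ioo_subset_Icc_self).stronglyMeasurableAtFilter isOpen_Ioo x hx)
    (hf.continuousAt (Icc_mem_nhds hx.1 hx.2))

theorem integral_mul_deriv_primitive {F g : ℝ → ℝ} (hg : IntervalIntegrable g volume a b) :
    ∫ x in a..b, F x * deriv (fun x => ∫ s in a..x, g s) x = ∫ x in a..b, F x * g x := by
  apply intervalIntegral.integral_congr_ae
  filter_upwards [hg.ae_hasDerivAt_integral] with x hx hx'
  rw [(hx (uIoc_subset_uIcc hx') a left_mem_uIcc).deriv]

theorem integral_mul_primitive {f g : ℝ → ℝ} (hf : IntervalIntegrable f volume a b)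
    (hg : IntervalIntegrable g volume a b) :
    ∫ x in a..b, f x * ∫ s in a..x, g s
      = (∫ x in a..b, f x) * (∫ x in a..b, g x) - ∫ x in a..b, (∫ s in a..x, f s) * g x := by
  have hF := hf.absolutelyContinuousOnInterval_intervalIntegral left_mem_uIcc
  have hG := hg.absolutelyContinuousOnInterval_intervalIntegral left_mem_uIcc
  have hparts := hG.integral_mul_deriv_eq_deriv_mul hF
  simp only [mul_comm (deriv _ _), integral_mul_deriv_primitive hf,
    integral_mul_deriv_primitive hg, intervalIntegral.integral_same, mul_zero, sub_zero] at hparts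
  simpa only [mul_comm] using hparts

theorem sq_integral_mul_le {α : Type*} [MeasurableSpace α] {μ : Measure α} {f g : α → ℝ}
    (hf : MemLp f 2 μ) (hg : MemLp g 2 μ) :
    (∫ x, f x * g x ∂μ) ^ 2 ≤ (∫ x, f x ^ 2 ∂μ) * ∫ x, g x ^ 2 ∂μ := by
  have hdiscrim : ∀ s : ℝ, 0 ≤ (∫ x, f x ^ 2 ∂μ) * (s * s) + (2 * ∫ x, f x * g x ∂μ) * s
      + ∫ x, g x ^ 2 ∂μ := by
    intro s
    have hfg : Integrable (fun x => f x * g x) μ := hf.integrable_mul hg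
    calc 0 ≤ ∫ x, (s * f x + g x) ^ 2 ∂μ := integral_nonneg fun x => sq_nonneg _
      _ = ∫ x, (s * s * f x ^ 2 + 2 * s * (f x * g x) + g x ^ 2) ∂μ := by congr with x; ring
      _ = _ := by
        rw [integral_add ((hf.integrable_sq.const_mul _).fun_add (hfg.const_mul _))
          hg.integrable_sq,
          integral_add (hf.integrable_sq.const_mul _) (hfg.const_mul _), integral_const_mul,
          integral_const_mul]
        ring
  have h := discrim_le_zero hdiscrim
  rw [discrim] at h
  linarith

theorem memLp_two_of_continuousOn {f : ℝ → ℝ} (hf : ContinuousOn f (Icc a b)) :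
    MemLp f 2 (volume.restrict (Ioo a b)) := by
  have h : MemLp f 2 (volume.restrict (Icc a b)) :=
    (memLp_two_iff_integrable_sq (hf.aestronglyMeasurable measurableSet_Icc)).2
      (hf.pow 2).integrableOn_Icc
  exact h.mono_measure (Measure.restrict_mono Ioo_subset_Icc_self le_rfl)

theorem intervalIntegral_eq_integral_Ioo (hab : a ≤ b) (f : ℝ → ℝ) :
    ∫ x in a..b, f x = ∫ x in Ioo a b, f x := by
  rw [intervalIntegral.integral_of_le hab, integral_Ioc_eq_integral_Ioo]

theorem intervalIntegrable_of_memLp_two (hab : a ≤ b) {f : ℝ → ℝ}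
    (hf : MemLp f 2 (volume.restrict (Ioo a b))) : IntervalIntegrable f volume a b :=
  (intervalIntegrable_iff_integrableOn_Ioo_of_le hab).2 (hf.integrable one_le_two)

theorem sq_primitive_le {f : ℝ → ℝ} (hf : MemLp f 2 (volume.restrict (Ioo a b))) {x : ℝ}
    (hx : x ∈ Icc a b) : (∫ s in a..x, f s) ^ 2 ≤ (b - a) * ∫ s in a..b, f s ^ 2 := by
  have hab := hx.1.trans hx.2
  have hsub : Ioo a x ⊆ Ioo a b := Ioo_subset_Ioo_right hx.2
  have hcs := sq_integral_mul_le (memLp_const 1)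
    (hf.mono_measure (Measure.restrict_mono hsub le_rfl))
  simp only [one_mul, one_pow, integral_const, measureReal_restrict_apply_univ,
    Real.volume_real_Ioo_of_le hx.1, smul_eq_mul, mul_one] at hcs
  rw [intervalIntegral_eq_integral_Ioo hx.1, intervalIntegral_eq_integral_Ioo hab]
  refine hcs.trans (mul_le_mul (by linarith [hx.2]) ?_ (integral_nonneg fun s => sq_nonneg _)
    (sub_nonneg.2 hab))
  exact setIntegral_mono_set hf.integrable_sq (Eventually.of_forall fun s => sq_nonneg _)
    hsub.eventuallyLE

theorem integral_sq_primitive_le (hab : a ≤ b) {f : ℝ → ℝ}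
    (hf : MemLp f 2 (volume.restrict (Ioo a b))) :
    ∫ x in a..b, (∫ s in a..x, f s) ^ 2 ≤ (b - a) ^ 2 * ∫ x in a..b, f x ^ 2 := by
  have hcont := continuousOn_primitive hab (intervalIntegrable_of_memLp_two hab hf)
  calc ∫ x in a..b, (∫ s in a..x, f s) ^ 2
      ≤ ∫ _ in a..b, (b - a) * ∫ x in a..b, f x ^ 2 :=
        intervalIntegral.integral_mono_on hab ((hcont.pow 2).intervalIntegrable_of_Icc hab)
          intervalIntegrable_const fun x hx => sq_primitive_le hf hx
    _ = (b - a) ^ 2 * ∫ x in a..b, f x ^ 2 := by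
        rw [intervalIntegral.integral_const, smul_eq_mul]; ring

theorem le_mul_exp_of_hasDerivAt_le {E E' : ℝ → ℝ} {α E₀ : ℝ}
    (hd : ∀ t > 0, HasDerivAt E (E' t) t) (hle : ∀ t > 0, E' t ≤ -α * E t)
    (hlim : Tendsto E (𝓝[>] 0) (𝓝 E₀)) {t : ℝ} (ht : 0 < t) : E t ≤ E₀ * Real.exp (-α * t) := by
  have hd' : ∀ s > 0, HasDerivAt (fun s => E s * Real.exp (α * s))
      ((E' s + α * E s) * Real.exp (α * s)) s := fun s hs =>
    ((hd s hs).mul ((hasDerivAt_id s).const_mul α).exp).congr_deriv (by simp only [id]; ring)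
  have hanti : AntitoneOn (fun s => E s * Real.exp (α * s)) (Ioi 0) := by
    refine antitoneOn_of_hasDerivWithinAt_nonpos (convex_Ioi 0)
      (fun s hs => (hd' s hs).continuousAt.continuousWithinAt)
      (fun s hs => (hd' s (interior_subset hs)).hasDerivWithinAt) fun s hs => ?_
    exact mul_nonpos_of_nonpos_of_nonneg (by linarith [hle s (interior_subset hs)])
      (Real.exp_pos _).le
  have hlim' : Tendsto (fun s => E s * Real.exp (α * s)) (𝓝[>] 0) (𝓝 E₀) := by
    have hexp : Continuous fun s : ℝ => Real.exp (α * s) := by fun_prop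
    simpa using hlim.mul (hexp.tendsto' 0 1 (by simp) |>.mono_left nhdsWithin_le_nhds)
  have h : E t * Real.exp (α * t) ≤ E₀ := by
    refine ge_of_tendsto hlim' ?_
    filter_upwards [Ioo_mem_nhdsGT ht] with s hs using hanti hs.1 ht hs.2.le
  rwa [neg_mul, Real.exp_neg, ← div_eq_mul_inv, le_div_iff₀ (Real.exp_pos _)]

end Calculus

/-! ### The boundary layer -/

section Derivative

variable {f : ℝ → ℝ} {x : ℝ}

theorem dx_eq_of_hasDerivAt {f' : ℝ} (hx : x ∈ Ioo (-1 : ℝ) 1) (hf : HasDerivAt f f' x) :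
    dx f x = f' := by
  rw [dx, derivWithin_of_mem_nhds (Icc_mem_nhds hx.1 hx.2), hf.deriv]

theorem hasDerivAt_dx (hf : DifferentiableOn ℝ f (Ioo (-1) 1)) (hx : x ∈ Ioo (-1 : ℝ) 1) :
    HasDerivAt f (dx f x) x := by
  have h := (hf.differentiableAt (Ioo_mem_nhds hx.1 hx.2)).hasDerivAt
  rwa [← dx_eq_of_hasDerivAt hx h] at h

theorem IsC1C2.continuousOn (hf : IsC1C2 f) : ContinuousOn f (Icc (-1) 1) := hf.1.continuousOn

theorem IsC1C2.continuousOn_dx (hf : IsC1C2 f) : ContinuousOn (dx f) (Icc (-1) 1) :=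
  hf.1.continuousOn_derivWithin (uniqueDiffOn_Icc (by norm_num)) le_rfl

theorem IsC1C2.hasDerivAt (hf : IsC1C2 f) (hx : x ∈ Ioo (-1 : ℝ) 1) : HasDerivAt f (dx f x) x :=
  hasDerivAt_dx (hf.2.differentiableOn (by simp)) hx

theorem IsC1C2.hasDerivAt_dx (hf : IsC1C2 f) (hx : x ∈ Ioo (-1 : ℝ) 1) :
    HasDerivAt (dx f) (dx (dx f) x) x := by
  have h := hf.2.derivWithin (m := 1) (uniqueDiffOn_Ioo (-1 : ℝ) 1) (by norm_num)
  refine PNP.hasDerivAt_dx ((h.differentiableOn (by simp)).congr fun y hy => ?_) hx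
  rw [dx_eq_of_hasDerivAt hy (hf.hasDerivAt hy),
    derivWithin_of_mem_nhds (Ioo_mem_nhds hy.1 hy.2), (hf.hasDerivAt hy).deriv]

end Derivative

section SteadyDensities

variable {m₀ : ℝ} {ψ : ℝ → ℝ} {ψ' x : ℝ}

theorem integral_exp_pos (hψ : ContinuousOn ψ (Icc (-1) 1)) :
    0 < ∫ y in (-1 : ℝ)..1, Real.exp (ψ y) :=
  intervalIntegral.intervalIntegral_pos_of_pos_on
    (hψ.rexp.intervalIntegrable_of_Icc (by norm_num)) (fun _ _ => Real.exp_pos _) (by norm_num)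

theorem pSteady_eq_nSteady_neg : pSteady m₀ ψ = nSteady m₀ (fun x => -ψ x) := rfl

theorem continuousOn_nSteady (hψ : ContinuousOn ψ (Icc (-1) 1)) :
    ContinuousOn (nSteady m₀ ψ) (Icc (-1) 1) := (hψ.rexp.const_smul m₀).div_const _

theorem continuousOn_pSteady (hψ : ContinuousOn ψ (Icc (-1) 1)) :
    ContinuousOn (pSteady m₀ ψ) (Icc (-1) 1) := continuousOn_nSteady hψ.fun_neg

theorem continuousOn_deltaSteady (hψ : ContinuousOn ψ (Icc (-1) 1)) :
    ContinuousOn (deltaSteady m₀ ψ) (Icc (-1) 1) :=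
  (continuousOn_nSteady hψ).sub (continuousOn_pSteady hψ)

theorem continuousOn_etaSteady (hψ : ContinuousOn ψ (Icc (-1) 1)) :
    ContinuousOn (etaSteady m₀ ψ) (Icc (-1) 1) :=
  (continuousOn_nSteady hψ).add (continuousOn_pSteady hψ)

theorem hasDerivAt_nSteady (h : HasDerivAt ψ ψ' x) :
    HasDerivAt (nSteady m₀ ψ) (nSteady m₀ ψ x * ψ') x :=
  ((h.exp.const_mul m₀).div_const _).congr_deriv (by rw [nSteady]; ring)

theorem hasDerivAt_pSteady (h : HasDerivAt ψ ψ' x) :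
    HasDerivAt (pSteady m₀ ψ) (-(pSteady m₀ ψ x * ψ')) x :=
  (hasDerivAt_nSteady (m₀ := m₀) h.fun_neg).congr_deriv (by rw [pSteady_eq_nSteady_neg]; ring)

theorem hasDerivAt_etaSteady (h : HasDerivAt ψ ψ' x) :
    HasDerivAt (etaSteady m₀ ψ) (deltaSteady m₀ ψ x * ψ') x :=
  ((hasDerivAt_nSteady h).add (hasDerivAt_pSteady h)).congr_deriv (by rw [deltaSteady]; ring)

theorem hasDerivAt_deltaSteady (h : HasDerivAt ψ ψ' x) :
    HasDerivAt (deltaSteady m₀ ψ) (etaSteady m₀ ψ x * ψ') x :=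
  ((hasDerivAt_nSteady h).sub (hasDerivAt_pSteady h)).congr_deriv (by rw [etaSteady]; ring)

theorem nSteady_pos (hm : 0 < m₀) (hψ : ContinuousOn ψ (Icc (-1) 1)) (x : ℝ) :
    0 < nSteady m₀ ψ x := div_pos (mul_pos hm (Real.exp_pos _)) (integral_exp_pos hψ)

theorem etaSteady_pos (hm : 0 < m₀) (hψ : ContinuousOn ψ (Icc (-1) 1)) (x : ℝ) :
    0 < etaSteady m₀ ψ x := add_pos (nSteady_pos hm hψ x) (nSteady_pos hm hψ.fun_neg x)

theorem nSteady_mul_pSteady (x : ℝ) :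
    nSteady m₀ ψ x * pSteady m₀ ψ x
      = m₀ ^ 2 / ((∫ y in (-1 : ℝ)..1, Real.exp (ψ y)) * ∫ y in (-1 : ℝ)..1, Real.exp (-ψ y)) := by
  have h : Real.exp (ψ x) * Real.exp (-ψ x) = 1 := by rw [← Real.exp_add]; simp
  rw [nSteady, pSteady, div_mul_div_comm]
  congr 1
  linear_combination m₀ ^ 2 * h

theorem sq_etaSteady (x : ℝ) :
    etaSteady m₀ ψ x ^ 2 = deltaSteady m₀ ψ x ^ 2
      + 4 * (m₀ ^ 2 / ((∫ y in (-1 : ℝ)..1, Real.exp (ψ y))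
        * ∫ y in (-1 : ℝ)..1, Real.exp (-ψ y))) := by
  rw [← nSteady_mul_pSteady x, etaSteady, deltaSteady]; ring

theorem etaSteady_le_of_deltaSteady_eq_zero (hm : 0 < m₀) (hψ : ContinuousOn ψ (Icc (-1) 1))
    {y : ℝ} (hy : deltaSteady m₀ ψ y = 0) (x : ℝ) : etaSteady m₀ ψ y ≤ etaSteady m₀ ψ x := by
  apply le_of_sq_le_sq _ (etaSteady_pos hm hψ x).le
  rw [sq_etaSteady y, sq_etaSteady x, hy]
  linarith [sq_nonneg (deltaSteady m₀ ψ x)]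

theorem integral_nSteady (hψ : ContinuousOn ψ (Icc (-1) 1)) :
    ∫ x in (-1 : ℝ)..1, nSteady m₀ ψ x = m₀ := by
  simp only [nSteady]
  rw [intervalIntegral.integral_div, intervalIntegral.integral_const_mul,
    mul_div_cancel_right₀ _ (integral_exp_pos hψ).ne']

theorem integral_deltaSteady (hψ : ContinuousOn ψ (Icc (-1) 1)) :
    ∫ x in (-1 : ℝ)..1, deltaSteady m₀ ψ x = 0 := by
  simp only [deltaSteady]
  rw [intervalIntegral.integral_sub
    ((continuousOn_nSteady hψ).intervalIntegrable_of_Icc (by norm_num))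
    ((continuousOn_pSteady hψ).intervalIntegrable_of_Icc (by norm_num)), integral_nSteady hψ,
    pSteady_eq_nSteady_neg, integral_nSteady hψ.fun_neg, sub_self]

theorem sub_mul_exp_sub_exp_nonneg (x y : ℝ) : 0 ≤ (x - y) * (Real.exp x - Real.exp y) := by
  rcases le_total x y with h | h
  · exact mul_nonneg_of_nonpos_of_nonpos (sub_nonpos.2 h) (sub_nonpos.2 (Real.exp_le_exp.2 h))
  · exact mul_nonneg (sub_nonneg.2 h) (sub_nonneg.2 (Real.exp_le_exp.2 h))

theorem sub_log_mul_nSteady_sub_nonneg (hm : 0 < m₀) (hψ : ContinuousOn ψ (Icc (-1) 1)) (x : ℝ) :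
    0 ≤ (ψ x - Real.log ((∫ y in (-1 : ℝ)..1, Real.exp (ψ y)) / 2))
      * (nSteady m₀ ψ x - m₀ / 2) := by
  have hZ := integral_exp_pos hψ
  set Z := ∫ y in (-1 : ℝ)..1, Real.exp (ψ y) with hZ_def
  have hdiff : nSteady m₀ ψ x - m₀ / 2
      = m₀ / Z * (Real.exp (ψ x) - Real.exp (Real.log (Z / 2))) := by
    rw [nSteady, ← hZ_def, Real.exp_log (by positivity)]
    field_simp
  rw [hdiff, mul_left_comm]
  exact mul_nonneg (by positivity) (sub_mul_exp_sub_exp_nonneg _ _)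

theorem mul_integral_le_integral_mul_nSteady (hm : 0 < m₀) (hψ : ContinuousOn ψ (Icc (-1) 1)) :
    m₀ / 2 * (∫ x in (-1 : ℝ)..1, ψ x) ≤ ∫ x in (-1 : ℝ)..1, ψ x * nSteady m₀ ψ x := by
  set c := Real.log ((∫ y in (-1 : ℝ)..1, Real.exp (ψ y)) / 2)
  have hn := continuousOn_nSteady (m₀ := m₀) hψ
  have hψn := (hψ.fun_mul hn).intervalIntegrable_of_Icc (μ := volume) (by norm_num)
  have hψm := (hψ.intervalIntegrable_of_Icc (μ := volume) (by norm_num)).const_mul (m₀ / 2)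
  have hcn := (hn.intervalIntegrable_of_Icc (μ := volume) (by norm_num)).const_mul c
  have h : 0 ≤ ∫ x in (-1 : ℝ)..1,
      (ψ x * nSteady m₀ ψ x - m₀ / 2 * ψ x - (c * nSteady m₀ ψ x - c * (m₀ / 2))) :=
    intervalIntegral.integral_nonneg (by norm_num) fun x _ =>
      (sub_log_mul_nSteady_sub_nonneg hm hψ x).trans_eq (by ring)
  rw [intervalIntegral.integral_sub (hψn.sub hψm) (hcn.sub intervalIntegrable_const),
    intervalIntegral.integral_sub hψn hψm,
    intervalIntegral.integral_sub hcn intervalIntegrable_const,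
    intervalIntegral.integral_const_mul, intervalIntegral.integral_const_mul,
    integral_nSteady hψ, intervalIntegral.integral_const, smul_eq_mul] at h
  linarith

theorem integral_mul_deltaSteady_nonneg (hm : 0 < m₀) (hψ : ContinuousOn ψ (Icc (-1) 1)) :
    0 ≤ ∫ x in (-1 : ℝ)..1, ψ x * deltaSteady m₀ ψ x := by
  have hn := mul_integral_le_integral_mul_nSteady hm hψ
  have hp := mul_integral_le_integral_mul_nSteady hm hψ.fun_neg
  simp only [intervalIntegral.integral_neg, ← pSteady_eq_nSteady_neg, neg_mul] at hp
  simp only [deltaSteady, mul_sub]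
  rw [intervalIntegral.integral_sub
    ((hψ.fun_mul (continuousOn_nSteady hψ)).intervalIntegrable_of_Icc (by norm_num))
    ((hψ.fun_mul (continuousOn_pSteady hψ)).intervalIntegrable_of_Icc (by norm_num))]
  linarith

end SteadyDensities

theorem two_mul_sq_constM {m₀ : ℝ} (hm : 0 ≤ m₀) (φb : ℝ) :
    2 * constM m₀ φb ^ 2 = m₀ / Real.exp φb := by
  rw [constM, Real.sq_sqrt (by positivity)]
  field_simp

namespace IsBoundaryLayer

variable {ε γ m₀ φb : ℝ} {ψ : ℝ → ℝ} {x : ℝ}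

theorem continuousOn (h : IsBoundaryLayer ε γ m₀ φb ψ) : ContinuousOn ψ (Icc (-1) 1) :=
  h.regular.continuousOn

theorem continuousOn_dx (h : IsBoundaryLayer ε γ m₀ φb ψ) : ContinuousOn (dx ψ) (Icc (-1) 1) :=
  h.regular.continuousOn_dx

theorem hasDerivAt_dx (h : IsBoundaryLayer ε γ m₀ φb ψ) (hε : ε ≠ 0) (hx : x ∈ Ioo (-1 : ℝ) 1) :
    HasDerivAt (dx ψ) (deltaSteady m₀ ψ x / ε) x := by
  refine (h.regular.hasDerivAt_dx hx).congr_deriv ?_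
  rw [eq_div_iff hε, mul_comm]
  exact h.poisson x hx

theorem dx_right_eq_left (h : IsBoundaryLayer ε γ m₀ φb ψ) (hε : ε ≠ 0) :
    dx ψ 1 = dx ψ (-1) := by
  have hftc := intervalIntegral.integral_eq_sub_of_hasDerivAt_of_le (by norm_num)
    h.continuousOn_dx (fun x hx => h.hasDerivAt_dx hε hx)
    (((continuousOn_deltaSteady h.continuousOn).div_const ε).intervalIntegrable_of_Icc
      (by norm_num))
  rw [intervalIntegral.integral_div, integral_deltaSteady h.continuousOn, zero_div] at hftc
  linarith

theorem sub_eq (h : IsBoundaryLayer ε γ m₀ φb ψ) (hε : ε ≠ 0) :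
    ψ 1 - ψ (-1) = 2 * φb - 2 * γ * dx ψ 1 := by
  have hl := h.robin_left
  rw [← h.dx_right_eq_left hε] at hl
  linarith [h.robin_right]

theorem integral_sq_dx_le_slope (h : IsBoundaryLayer ε γ m₀ φb ψ) (hm : 0 < m₀) (hε : 0 < ε) :
    ∫ x in (-1 : ℝ)..1, dx ψ x ^ 2 ≤ dx ψ 1 * (2 * φb - 2 * γ * dx ψ 1) := by
  have hparts := integral_mul_deriv_eq_of_continuousOn (by norm_num) h.continuousOn
    h.continuousOn_dx h.continuousOn_dx ((continuousOn_deltaSteady h.continuousOn).div_const ε)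
    (fun x hx => h.regular.hasDerivAt hx) (fun x hx => h.hasDerivAt_dx hε.ne' hx)
  have hψδ : 0 ≤ ∫ x in (-1 : ℝ)..1, ψ x * (deltaSteady m₀ ψ x / ε) := by
    simp only [← mul_div_assoc, intervalIntegral.integral_div]
    exact div_nonneg (integral_mul_deltaSteady_nonneg hm h.continuousOn) hε.le
  simp only [← sq, ← h.dx_right_eq_left hε.ne'] at hparts
  rw [← h.sub_eq hε.ne']
  linarith

theorem integral_sq_dx_le (h : IsBoundaryLayer ε γ m₀ φb ψ) (hm : 0 < m₀) (hε : 0 < ε)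
    (hγ : 0 < γ) : ∫ x in (-1 : ℝ)..1, dx ψ x ^ 2 ≤ φb ^ 2 / (2 * γ) := by
  refine (h.integral_sq_dx_le_slope hm hε).trans ?_
  rw [le_div_iff₀ (by positivity)]
  nlinarith [sq_nonneg (2 * γ * dx ψ 1 - φb)]

theorem dx_right_nonneg (h : IsBoundaryLayer ε γ m₀ φb ψ) (hm : 0 < m₀) (hφ : 0 ≤ φb)
    (hε : 0 < ε) (hγ : 0 < γ) : 0 ≤ dx ψ 1 := by
  have hslope := h.integral_sq_dx_le_slope hm hε
  have hsq : 0 ≤ ∫ x in (-1 : ℝ)..1, dx ψ x ^ 2 :=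
    intervalIntegral.integral_nonneg (by norm_num) fun x _ => sq_nonneg _
  by_contra! hneg
  nlinarith [mul_pos hγ (neg_pos.2 hneg)]

theorem first_integral (h : IsBoundaryLayer ε γ m₀ φb ψ) (hε : ε ≠ 0) (hx : x ∈ Icc (-1 : ℝ) 1) :
    ε / 2 * dx ψ x ^ 2 - etaSteady m₀ ψ x = ε / 2 * dx ψ (-1) ^ 2 - etaSteady m₀ ψ (-1) := by
  refine eq_left_of_hasDerivAt_zero (f := fun x => ε / 2 * dx ψ x ^ 2 - etaSteady m₀ ψ x)
    ((continuousOn_const.mul (h.continuousOn_dx.pow 2)).sub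
      (continuousOn_etaSteady h.continuousOn)) (fun y hy => ?_) hx
  refine ((((h.hasDerivAt_dx hε hy).pow 2).const_mul (ε / 2)).sub
    (hasDerivAt_etaSteady (m₀ := m₀) (h.regular.hasDerivAt hy))).congr_deriv ?_
  simp only [Nat.cast_ofNat, Nat.add_one_sub_one, pow_one]
  field_simp
  ring

theorem sq_dx_le_of_deltaSteady_eq_zero (h : IsBoundaryLayer ε γ m₀ φb ψ) (hm : 0 < m₀)
    (hε : 0 < ε) {y : ℝ} (hy : y ∈ Icc (-1 : ℝ) 1) (hy0 : deltaSteady m₀ ψ y = 0)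
    (hx : x ∈ Icc (-1 : ℝ) 1) : dx ψ y ^ 2 ≤ dx ψ x ^ 2 := by
  have heta := etaSteady_le_of_deltaSteady_eq_zero hm h.continuousOn hy0 x
  have hfirst := (h.first_integral hε.ne' hy).trans (h.first_integral hε.ne' hx).symm
  nlinarith

-- An interior minimum of `ψ_x` is a zero of `δ⁰`, where `ψ_x²` is minimal too; so `ψ_x` cannot
-- change sign.
theorem dx_nonneg (h : IsBoundaryLayer ε γ m₀ φb ψ) (hm : 0 < m₀) (hφ : 0 ≤ φb) (hε : 0 < ε)
    (hγ : 0 < γ) (hx : x ∈ Icc (-1 : ℝ) 1) : 0 ≤ dx ψ x := by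
  have hright := h.dx_right_nonneg hm hφ hε hγ
  obtain ⟨y, hy, hmin⟩ := isCompact_Icc.exists_isMinOn
    (nonempty_Icc.2 (by norm_num : (-1 : ℝ) ≤ 1)) h.continuousOn_dx
  refine le_trans ?_ (hmin hx)
  rcases eq_or_lt_of_le hy.1 with rfl | hleft
  · rwa [← h.dx_right_eq_left hε.ne']
  rcases eq_or_lt_of_le hy.2 with rfl | hlt
  · exact hright
  have hy0 : deltaSteady m₀ ψ y = 0 := by
    simpa [hε.ne'] using (hmin.isLocalMin (Icc_mem_nhds hleft hlt)).hasDerivAt_eq_zero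
      (h.hasDerivAt_dx hε.ne' ⟨hleft, hlt⟩)
  by_contra! hneg
  obtain ⟨z, hz, hz0⟩ : (0 : ℝ) ∈ dx ψ '' Icc y 1 :=
    intermediate_value_Icc hy.2 (h.continuousOn_dx.mono (Icc_subset_Icc_left hy.1))
      ⟨hneg.le, hright⟩
  have hsq := h.sq_dx_le_of_deltaSteady_eq_zero hm hε hy hy0 ⟨hy.1.trans hz.1, hz.2⟩
  rw [hz0] at hsq
  nlinarith

theorem monotoneOn (h : IsBoundaryLayer ε γ m₀ φb ψ) (hm : 0 < m₀) (hφ : 0 ≤ φb) (hε : 0 < ε)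
    (hγ : 0 < γ) : MonotoneOn ψ (Icc (-1) 1) :=
  monotoneOn_of_hasDerivWithinAt_nonneg (convex_Icc (-1) 1) h.continuousOn
    (fun _ hx => (h.regular.hasDerivAt (by rwa [interior_Icc] at hx)).hasDerivWithinAt)
    (fun _ hx => h.dx_nonneg hm hφ hε hγ (interior_subset hx))

end IsBoundaryLayer

theorem integral_exp_le {f : ℝ → ℝ} {a b c : ℝ} (hab : a ≤ b) (hf : ContinuousOn f (Icc a b))
    (hfc : ∀ x ∈ Icc a b, f x ≤ c) : ∫ x in a..b, Real.exp (f x) ≤ (b - a) * Real.exp c := by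
  rw [← smul_eq_mul, ← intervalIntegral.integral_const]
  exact intervalIntegral.integral_mono_on hab (hf.rexp.intervalIntegrable_of_Icc hab)
    intervalIntegrable_const fun x hx => Real.exp_le_exp.2 (hfc x hx)

namespace IsBoundaryLayer

variable {ε γ m₀ φb : ℝ} {ψ : ℝ → ℝ}

theorem integral_exp_mul_integral_exp_neg_le (h : IsBoundaryLayer ε γ m₀ φb ψ) (hm : 0 < m₀)
    (hφ : 0 ≤ φb) (hε : 0 < ε) (hγ : 0 < γ) :
    (∫ y in (-1 : ℝ)..1, Real.exp (ψ y)) * (∫ y in (-1 : ℝ)..1, Real.exp (-ψ y))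
      ≤ 4 * Real.exp φb ^ 2 := by
  have hmono := h.monotoneOn hm hφ hε hγ
  have hexp := integral_exp_le (by norm_num) h.continuousOn fun x hx =>
    hmono hx (right_mem_Icc.2 (by norm_num)) hx.2
  have hexp_neg := integral_exp_le (by norm_num) h.continuousOn.fun_neg fun x hx =>
    neg_le_neg (hmono (left_mem_Icc.2 (by norm_num)) hx hx.1)
  have hjump : ψ 1 + -ψ (-1) ≤ φb + φb := by
    nlinarith [h.sub_eq hε.ne', h.dx_right_nonneg hm hφ hε hγ]
  calc _ ≤ ((1 - -1) * Real.exp (ψ 1)) * ((1 - -1) * Real.exp (-ψ (-1))) :=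
        mul_le_mul hexp hexp_neg (integral_exp_pos h.continuousOn.fun_neg).le (by positivity)
    _ = 4 * Real.exp (ψ 1 + -ψ (-1)) := by rw [Real.exp_add]; ring
    _ ≤ 4 * Real.exp (φb + φb) := by gcongr
    _ = _ := by rw [Real.exp_add]; ring

theorem two_mul_sq_constM_le_etaSteady (h : IsBoundaryLayer ε γ m₀ φb ψ) (hm : 0 < m₀)
    (hφ : 0 ≤ φb) (hε : 0 < ε) (hγ : 0 < γ) (x : ℝ) :
    2 * constM m₀ φb ^ 2 ≤ etaSteady m₀ ψ x := by
  apply le_of_sq_le_sq _ (etaSteady_pos hm h.continuousOn x).le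
  have hZ := mul_pos (integral_exp_pos h.continuousOn) (integral_exp_pos h.continuousOn.fun_neg)
  calc (2 * constM m₀ φb ^ 2) ^ 2 = 4 * (m₀ ^ 2 / (4 * Real.exp φb ^ 2)) := by
        rw [two_mul_sq_constM hm.le, div_pow]; ring
    _ ≤ 4 * (m₀ ^ 2 / ((∫ y in (-1 : ℝ)..1, Real.exp (ψ y))
          * ∫ y in (-1 : ℝ)..1, Real.exp (-ψ y))) := by
        have hle := h.integral_exp_mul_integral_exp_neg_le hm hφ hε hγ
        exact mul_le_mul_of_nonneg_left (div_le_div_of_nonneg_left (sq_nonneg _) hZ hle)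
          zero_le_four
    _ ≤ etaSteady m₀ ψ x ^ 2 := by
        rw [sq_etaSteady]
        linarith [sq_nonneg (deltaSteady m₀ ψ x)]

theorem exists_etaSteady_bounds (h : IsBoundaryLayer ε γ m₀ φb ψ) (hm : 0 < m₀) (hφ : 0 ≤ φb)
    (hε : 0 < ε) (hγ : 0 < γ) :
    ∃ κ, 2 * constM m₀ φb ^ 2 ≤ κ ∧ ∀ x ∈ Icc (-1 : ℝ) 1,
      κ ≤ etaSteady m₀ ψ x ∧ etaSteady m₀ ψ x ≤ κ + ε / 2 * dx ψ x ^ 2 := by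
  obtain ⟨y, hy, hy0⟩ := exists_hasDerivAt_eq_zero (by norm_num : (-1 : ℝ) < 1)
    h.continuousOn_dx (h.dx_right_eq_left hε.ne').symm fun x hx => h.hasDerivAt_dx hε.ne' hx
  have hδ : deltaSteady m₀ ψ y = 0 := by simpa [hε.ne'] using hy0
  refine ⟨etaSteady m₀ ψ y, h.two_mul_sq_constM_le_etaSteady hm hφ hε hγ y, fun x hx =>
    ⟨etaSteady_le_of_deltaSteady_eq_zero hm h.continuousOn hδ x, ?_⟩⟩
  have hfirst := (h.first_integral hε.ne' hx).trans
    (h.first_integral hε.ne' (Ioo_subset_Icc_self hy)).symm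
  have hsq : 0 ≤ ε / 2 * dx ψ y ^ 2 := by positivity
  linarith

end IsBoundaryLayer

theorem abs_exp_sub_one_le_abs_mul_exp (y : ℝ) : |Real.exp y - 1| ≤ |y| * Real.exp |y| := by
  have h := Complex.norm_exp_sub_sum_le_norm_mul_exp y 1
  simpa [← Complex.ofReal_exp, ← Complex.ofReal_one, ← Complex.ofReal_sub] using h

theorem one_le_constK {φb : ℝ} (hφ : 0 < φb) : 1 ≤ constK φb := by
  have hbdd : BddAbove ((fun y : ℝ => |Real.exp y - 1| / |y|) '' {y : ℝ | 0 < |y| ∧ |y| ≤ φb}) := by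
    refine ⟨Real.exp φb, ?_⟩
    rintro _ ⟨y, ⟨hy, hyφ⟩, rfl⟩
    exact (div_le_iff₀' hy).2 ((abs_exp_sub_one_le_abs_mul_exp y).trans (by gcongr))
  refine le_trans ?_ (le_csSup hbdd ⟨φb, ⟨abs_pos.2 hφ.ne', (abs_of_pos hφ).le⟩, rfl⟩)
  change 1 ≤ |Real.exp φb - 1| / |φb|
  rw [abs_of_pos hφ, one_le_div hφ, le_abs]
  exact Or.inl (by linarith [Real.add_one_le_exp φb])

/-! ### Integrals depending on time -/

section Parametric

variable {f f' : ℝ → ℝ → ℝ} {U s : Set ℝ} {a b t : ℝ}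

theorem continuousOn_slice (hf : ContinuousOn (fun q : ℝ × ℝ => f q.1 q.2) (U ×ˢ s))
    (ht : t ∈ U) : ContinuousOn (f t) s :=
  hf.comp (f := fun x => (t, x)) (by fun_prop) fun _ hx => ⟨ht, hx⟩

theorem hasDerivAt_integral_of_continuousOn (hU : IsOpen U) (hab : a ≤ b)
    (hf : ContinuousOn (fun q : ℝ × ℝ => f q.1 q.2) (U ×ˢ Icc a b))
    (hf' : ContinuousOn (fun q : ℝ × ℝ => f' q.1 q.2) (U ×ˢ Icc a b))
    (hd : ∀ t ∈ U, ∀ x ∈ Icc a b, HasDerivAt (fun s => f s x) (f' t x) t) (ht : t ∈ U) :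
    HasDerivAt (fun s => ∫ x in a..b, f s x) (∫ x in a..b, f' t x) t := by
  obtain ⟨K, hK, htK, hKU⟩ := exists_compact_subset hU ht
  obtain ⟨C, hC⟩ := (hK.prod isCompact_Icc).exists_bound_of_continuousOn
    (hf'.mono (prod_mono_left hKU))
  have hsub : uIoc a b ⊆ Icc a b := uIoc_of_le hab ▸ Ioc_subset_Icc_self
  have hmeas : ∀ {g : ℝ → ℝ}, ContinuousOn g (Icc a b) →
      AEStronglyMeasurable g (volume.restrict (uIoc a b)) := fun hg =>
    (hg.mono hsub).aestronglyMeasurable measurableSet_uIoc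
  refine (intervalIntegral.hasDerivAt_integral_of_dominated_loc_of_deriv_le (bound := fun _ => C)
    (mem_interior_iff_mem_nhds.1 htK) ?_
    ((continuousOn_slice hf ht).intervalIntegrable_of_Icc hab) (hmeas (continuousOn_slice hf' ht))
    (.of_forall fun x hx s hs => hC (s, x) ⟨hs, hsub hx⟩) intervalIntegrable_const
    (.of_forall fun x hx s hs => hd s (hKU hs) x (hsub hx))).2
  filter_upwards [hU.mem_nhds ht] with s hs using hmeas (continuousOn_slice hf hs)

theorem tendstoLocallyUniformlyOn_slice
    (hf : ContinuousOn (fun q : ℝ × ℝ => f q.1 q.2) (U ×ˢ s)) {x₀ : ℝ} (hx₀ : x₀ ∈ s)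
    {l : Filter ℝ} (hl : l ≤ 𝓝[s] x₀) :
    TendstoLocallyUniformlyOn (fun x t => f t x) (fun t => f t x₀) l U := by
  rw [Metric.tendstoLocallyUniformlyOn_iff]
  intro e he t ht
  have h := Metric.continuousWithinAt_iff'.1 (hf (t, x₀) ⟨ht, hx₀⟩) (e / 2) (half_pos he)
  rw [nhdsWithin_prod_eq] at h
  obtain ⟨V, hV, W, hW, hVW⟩ := mem_prod_iff.1 h
  refine ⟨V, hV, mem_of_superset (hl hW) fun x hx t' ht' => ?_⟩
  have h₁ : dist (f t' x) (f t x₀) < e / 2 := hVW (mk_mem_prod ht' hx)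
  have h₂ : dist (f t' x₀) (f t x₀) < e / 2 :=
    hVW (mk_mem_prod ht' (mem_of_mem_nhdsWithin hx₀ hW))
  linarith [dist_triangle_right (f t' x₀) (f t' x) (f t x₀)]

theorem tendsto_integral_add_sub {g : ℝ → ℝ} (hab : a < b) (hg : ContinuousOn g (Icc a b)) :
    Tendsto (fun r => ∫ x in (a + r)..(b - r), g x) (𝓝[Icc 0 ((b - a) / 2)] 0)
      (𝓝 (∫ x in a..b, g x)) := by
  have hint := hg.intervalIntegrable_of_Icc (μ := volume) hab.le
  have hmem : ∀ r ∈ Icc 0 ((b - a) / 2), a + r ∈ Icc a b ∧ b - r ∈ Icc a b := fun r hr =>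
    ⟨⟨by linarith [hr.1], by linarith [hr.2]⟩, ⟨by linarith [hr.2], by linarith [hr.1]⟩⟩
  have hcont : ContinuousOn (fun r => (∫ x in a..(b - r), g x) - ∫ x in a..(a + r), g x)
      (Icc 0 ((b - a) / 2)) :=
    ((continuousOn_primitive hab.le hint).comp (f := fun r => b - r) (by fun_prop)
      fun r hr => (hmem r hr).2).sub
    ((continuousOn_primitive hab.le hint).comp (f := fun r => a + r) (by fun_prop)
      fun r hr => (hmem r hr).1)
  have hlim := hcont 0 ⟨le_rfl, by linarith⟩
  simp only [ContinuousWithinAt, sub_zero, add_zero, intervalIntegral.integral_same] at hlim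
  refine hlim.congr' ?_
  filter_upwards [self_mem_nhdsWithin] with r hr
  exact intervalIntegral.integral_interval_sub_left
    (intervalIntegrable_of_mem_Icc hint (hmem r hr).2)
    (intervalIntegrable_of_mem_Icc hint (hmem r hr).1)

/- As `u'` is not assumed continuous up to the endpoints, the integral is differentiated over
`[a + r, b - r]`; the derivatives then converge locally uniformly in time as `r → 0`. -/
theorem hasDerivAt_integral_of_conservation {u u' F : ℝ → ℝ → ℝ} (hU : IsOpen U) (hab : a ≤ b)
    (hu : ContinuousOn (fun q : ℝ × ℝ => u q.1 q.2) (U ×ˢ Icc a b))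
    (hu' : ContinuousOn (fun q : ℝ × ℝ => u' q.1 q.2) (U ×ˢ Ioo a b))
    (hF : ContinuousOn (fun q : ℝ × ℝ => F q.1 q.2) (U ×ˢ Icc a b))
    (hut : ∀ t ∈ U, ∀ x ∈ Ioo a b, HasDerivAt (fun s => u s x) (u' t x) t)
    (hFx : ∀ t ∈ U, ∀ x ∈ Ioo a b, HasDerivAt (F t) (u' t x) x) (ht : t ∈ U) :
    HasDerivAt (fun s => ∫ x in a..b, u s x) (F t b - F t a) t := by
  obtain rfl | hab := hab.eq_or_lt
  · simpa using hasDerivAt_const t (0 : ℝ)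
  have hinner : ∀ r ∈ Ioo 0 ((b - a) / 2), ∀ t ∈ U,
      HasDerivAt (fun s => ∫ x in (a + r)..(b - r), u s x) (F t (b - r) - F t (a + r)) t := by
    intro r hr t ht
    have hle : a + r ≤ b - r := by linarith [hr.2]
    have hsub : Icc (a + r) (b - r) ⊆ Ioo a b :=
      Icc_subset_Ioo (by linarith [hr.1]) (by linarith [hr.1])
    have hftc := intervalIntegral.integral_eq_sub_of_hasDerivAt_of_le hle
      ((continuousOn_slice hF ht).mono (hsub.trans Ioo_subset_Icc_self))
      (fun x hx => hFx t ht x (hsub (Ioo_subset_Icc_self hx)))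
      (((continuousOn_slice hu' ht).mono hsub).intervalIntegrable_of_Icc hle)
    exact hftc ▸ hasDerivAt_integral_of_continuousOn hU hle
      (hu.mono (prod_mono_right (hsub.trans Ioo_subset_Icc_self)))
      (hu'.mono (prod_mono_right hsub)) (fun t ht x hx => hut t ht x (hsub hx)) ht
  have hG : ContinuousOn (fun q : ℝ × ℝ => F q.1 (b - q.2) - F q.1 (a + q.2))
      (U ×ˢ Icc 0 ((b - a) / 2)) :=
    (hF.comp (f := fun q : ℝ × ℝ => (q.1, b - q.2)) (by fun_prop) fun q hq =>
      ⟨hq.1, by linarith [hq.2.2], by linarith [hq.2.1]⟩).sub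
    (hF.comp (f := fun q : ℝ × ℝ => (q.1, a + q.2)) (by fun_prop) fun q hq =>
      ⟨hq.1, by linarith [hq.2.1], by linarith [hq.2.2]⟩)
  have hpos : 0 < (b - a) / 2 := by linarith
  have hl : 𝓝[Ioo 0 ((b - a) / 2)] (0 : ℝ) ≤ 𝓝[Icc 0 ((b - a) / 2)] 0 :=
    nhdsWithin_mono _ Ioo_subset_Icc_self
  have := left_nhdsWithin_Ioo_neBot hpos
  refine (hasDerivAt_of_tendstoLocallyUniformlyOn hU
    (tendstoLocallyUniformlyOn_slice hG (left_mem_Icc.2 hpos.le) hl)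
    (by filter_upwards [self_mem_nhdsWithin] with r hr t ht using hinner r hr t ht)
    (fun t ht => (tendsto_integral_add_sub hab (continuousOn_slice hu ht)).mono_left hl)
    ht).congr_deriv (by simp only [sub_zero, add_zero])

theorem tendstoUniformlyOn_primitive {ι : Type*} {l : Filter ι} {g : ι → ℝ → ℝ} {g₀ : ℝ → ℝ}
    (hg : ∀ᶠ i in l, IntervalIntegrable (g i) volume a b) (hg₀ : IntervalIntegrable g₀ volume a b)
    (hlim : Tendsto (fun i => ∫ x in a..b, |g i x - g₀ x|) l (𝓝 0)) :
    TendstoUniformlyOn (fun i x => ∫ s in a..x, g i s) (fun x => ∫ s in a..x, g₀ s) l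
      (Icc a b) := by
  rw [Metric.tendstoUniformlyOn_iff]
  intro e he
  filter_upwards [hg, hlim.eventually (gt_mem_nhds he)] with i hi hlt x hx
  rw [dist_comm, Real.dist_eq, ← intervalIntegral.integral_sub (intervalIntegrable_of_mem_Icc hi hx)
    (intervalIntegrable_of_mem_Icc hg₀ hx)]
  exact ((intervalIntegral.abs_integral_le_integral_abs hx.1).trans
    (intervalIntegral.integral_mono_interval le_rfl hx.1 hx.2
      (.of_forall fun _ => abs_nonneg _) (hi.sub hg₀).abs)).trans_lt hlt

theorem continuousOn_parametric_primitive (hab : a ≤ b)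
    (hf : ContinuousOn (fun q : ℝ × ℝ => f q.1 q.2) (U ×ˢ Icc a b)) :
    ContinuousOn (fun q : ℝ × ℝ => ∫ s in a..q.2, f q.1 s) (U ×ˢ Icc a b) := by
  have hcont : Continuous (Function.uncurry fun (t : U) s => f t (projIcc a b hab s)) :=
    hf.comp_continuous (f := fun q : U × ℝ => ((q.1 : ℝ), (projIcc a b hab q.2 : ℝ))) (by fun_prop)
      fun q => ⟨q.1.2, (projIcc a b hab q.2).2⟩
  have hprim := intervalIntegral.continuous_parametric_primitive_of_continuous (μ := volume)
    (a₀ := a) hcont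
  rw [continuousOn_iff_continuous_domRestrict]
  refine (hprim.comp (f := fun q : ↥(U ×ˢ Icc a b) => ((⟨q.1.1, q.2.1⟩ : U), q.1.2))
    (by fun_prop)).congr fun ⟨⟨t, x⟩, _, hx⟩ => ?_
  refine intervalIntegral.integral_congr fun s hs => ?_
  rw [uIcc_of_le hx.1] at hs
  simp only [projIcc_of_mem hab ⟨hs.1, hs.2.trans hx.2⟩]

end Parametric

/-- `u` is a classical solution of the conservation law `u_t = F_x` on `(0, ∞) × (-1, 1)` with
no flux through `±1`, attaining its initial datum in `L¹`. Both equations of the linearized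
problem have this form. -/
structure IsNoFluxEvolution (u F : ℝ → ℝ → ℝ) : Prop where
  regular : IsParabolicRegular u
  initial : AttainsInitialData u
  cont_flux : ContinuousOn (fun q : ℝ × ℝ => F q.1 q.2) (Ioi 0 ×ˢ Icc (-1) 1)
  hasDerivAt_flux : ∀ t > 0, ∀ x ∈ Ioo (-1 : ℝ) 1, HasDerivAt (F t) (deriv (fun s => u s x) t) x
  flux_left : ∀ t > 0, F t (-1) = 0
  flux_right : ∀ t > 0, F t 1 = 0

namespace IsNoFluxEvolution

variable {u F : ℝ → ℝ → ℝ} {t : ℝ}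

theorem intervalIntegrable (h : IsNoFluxEvolution u F) (ht : 0 ≤ t) :
    IntervalIntegrable (u t) volume (-1) 1 := by
  obtain rfl | ht := ht.eq_or_lt
  · exact h.initial.1
  · exact (continuousOn_slice h.regular.cont ht).intervalIntegrable_of_Icc (by norm_num)

theorem hasDerivAt_prim (h : IsNoFluxEvolution u F) (ht : 0 < t) {x : ℝ}
    (hx : x ∈ Icc (-1 : ℝ) 1) : HasDerivAt (fun s => prim u s x) (F t x) t := by
  have hIcc : Icc (-1) x ⊆ Icc (-1) 1 := Icc_subset_Icc_right hx.2
  have hIoo : Ioo (-1) x ⊆ Ioo (-1) 1 := Ioo_subset_Ioo_right hx.2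
  have hd := hasDerivAt_integral_of_conservation isOpen_Ioi hx.1
    (h.regular.cont.mono (prod_mono_right hIcc)) (h.regular.cont_t.mono (prod_mono_right hIoo))
    (h.cont_flux.mono (prod_mono_right hIcc))
    (fun t ht x hx => ((h.regular.diff_t x (hIoo hx) t ht).differentiableAt
      (Ioi_mem_nhds ht)).hasDerivAt) (fun t ht x hx => h.hasDerivAt_flux t ht x (hIoo hx)) ht
  rwa [h.flux_left t ht, sub_zero] at hd

theorem tendstoUniformlyOn_prim (h : IsNoFluxEvolution u F) :
    TendstoUniformlyOn (prim u) (prim u 0) (𝓝[>] 0) (Icc (-1) 1) := by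
  refine tendstoUniformlyOn_primitive ?_ h.initial.1 h.initial.2
  filter_upwards [self_mem_nhdsWithin] with t ht using h.intervalIntegrable (le_of_lt ht)

theorem integral_eq (h : IsNoFluxEvolution u F) (ht : 0 < t) :
    ∫ x in (-1 : ℝ)..1, u t x = ∫ x in (-1 : ℝ)..1, u 0 x := by
  have hd : ∀ s > 0, HasDerivAt (fun s => prim u s 1) 0 s := fun s hs =>
    h.flux_right s hs ▸ h.hasDerivAt_prim hs (right_mem_Icc.2 (by norm_num))
  have hconst : ∀ s > 0, prim u s 1 = prim u t 1 := fun s hs =>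
    isOpen_Ioi.is_const_of_deriv_eq_zero isPreconnected_Ioi
      (fun r hr => (hd r hr).differentiableAt.differentiableWithinAt) (fun r hr => (hd r hr).deriv)
      hs ht
  refine tendsto_nhds_unique (tendsto_const_nhds.congr' ?_)
    (h.tendstoUniformlyOn_prim.tendsto_at (right_mem_Icc.2 (by norm_num)))
  filter_upwards [self_mem_nhdsWithin] with s hs using (hconst s hs).symm

theorem continuousOn_prim (h : IsNoFluxEvolution u F) (ht : 0 ≤ t) :
    ContinuousOn (prim u t) (Icc (-1) 1) :=
  continuousOn_primitive (by norm_num) (h.intervalIntegrable ht)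

theorem hasDerivAt_integral_sq_prim (h : IsNoFluxEvolution u F) (ht : 0 < t) :
    HasDerivAt (fun s => ∫ x in (-1 : ℝ)..1, prim u s x ^ 2)
      (2 * ∫ x in (-1 : ℝ)..1, prim u t x * F t x) t := by
  have hprim := continuousOn_parametric_primitive (by norm_num) h.regular.cont
  rw [← intervalIntegral.integral_const_mul]
  refine hasDerivAt_integral_of_continuousOn (f' := fun t x => 2 * (prim u t x * F t x))
    isOpen_Ioi (by norm_num) (hprim.pow 2) (continuousOn_const.mul (hprim.mul h.cont_flux))
    (fun t ht x hx => ((h.hasDerivAt_prim ht hx).pow 2).congr_deriv (by ring)) ht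

theorem tendsto_integral_sq_prim (h : IsNoFluxEvolution u F) :
    Tendsto (fun t => ∫ x in (-1 : ℝ)..1, prim u t x ^ 2) (𝓝[>] 0)
      (𝓝 (∫ x in (-1 : ℝ)..1, prim u 0 x ^ 2)) := by
  have hcont := h.continuousOn_prim le_rfl
  have hsq := (tendstoLocallyUniformlyOn_iff_tendstoUniformlyOn_of_compact isCompact_Icc).1
    (h.tendstoUniformlyOn_prim.tendstoLocallyUniformlyOn.mul₀
      h.tendstoUniformlyOn_prim.tendstoLocallyUniformlyOn hcont hcont)
  have hIcc : uIcc (-1 : ℝ) 1 = Icc (-1) 1 := uIcc_of_le (by norm_num)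
  simp only [sq]
  refine TendstoUniformlyOn.tendsto_intervalIntegral_of_continuousOn ?_ (hIcc ▸ hsq)
  filter_upwards [self_mem_nhdsWithin] with t ht
  exact hIcc ▸ (h.continuousOn_prim (le_of_lt ht)).mul (h.continuousOn_prim (le_of_lt ht))

end IsNoFluxEvolution

/-! ### Energy and dissipation -/

section Energy

theorem intervalIntegrable_of_continuousOn {f : ℝ → ℝ} (hf : ContinuousOn f (Icc (-1) 1)) :
    IntervalIntegrable f volume (-1) 1 := hf.intervalIntegrable_of_Icc (by norm_num)

theorem integral_eq_two_mul_mean (f : ℝ → ℝ) : ∫ x in (-1 : ℝ)..1, f x = 2 * mean f := by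
  rw [mean]; ring

theorem integral_sq_fluct {f : ℝ → ℝ} (hf : ContinuousOn f (Icc (-1) 1)) :
    ∫ x in (-1 : ℝ)..1, fluct f x ^ 2 = (∫ x in (-1 : ℝ)..1, f x ^ 2) - 2 * mean f ^ 2 := by
  have hsq := intervalIntegrable_of_continuousOn (hf.fun_pow 2)
  have hlin := (intervalIntegrable_of_continuousOn hf).const_mul (2 * mean f)
  calc ∫ x in (-1 : ℝ)..1, fluct f x ^ 2
      = ∫ x in (-1 : ℝ)..1, (f x ^ 2 - 2 * mean f * f x + mean f ^ 2) := by
        congr with x; rw [fluct]; ring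
    _ = _ := by
        rw [intervalIntegral.integral_add (hsq.sub hlin) intervalIntegrable_const,
          intervalIntegral.integral_sub hsq hlin, intervalIntegral.integral_const_mul,
          intervalIntegral.integral_const, smul_eq_mul, integral_eq_two_mul_mean f]
        ring

theorem two_mul_sq_mean_le {f : ℝ → ℝ} (hf : ContinuousOn f (Icc (-1) 1)) :
    2 * mean f ^ 2 ≤ ∫ x in (-1 : ℝ)..1, f x ^ 2 := by
  have h := intervalIntegral.integral_nonneg (μ := volume) (by norm_num : (-1 : ℝ) ≤ 1)
    fun x _ => sq_nonneg (fluct f x)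
  linarith [integral_sq_fluct hf]

theorem energy_eq {δ η : ℝ → ℝ → ℝ} {t : ℝ} (hD : ContinuousOn (prim δ t) (Icc (-1) 1))
    (hH : ContinuousOn (prim η t) (Icc (-1) 1)) :
    energy δ η t = 1 / 2 * ((∫ x in (-1 : ℝ)..1, prim δ t x ^ 2)
      + ∫ x in (-1 : ℝ)..1, prim η t x ^ 2) := by
  have hfluct : ∀ {f : ℝ → ℝ}, ContinuousOn f (Icc (-1) 1) →
      IntervalIntegrable (fun x => fluct f x ^ 2) volume (-1) 1 := fun hf =>
    intervalIntegrable_of_continuousOn ((hf.sub continuousOn_const).pow 2)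
  rw [energy, intervalIntegral.integral_add (hfluct hD) (hfluct hH), integral_sq_fluct hD,
    integral_sq_fluct hH]
  ring

end Energy

/-- `D` vanishes at `±1`, and `D`, its derivative `u` and its second derivative `w` are continuous
on `[-1, 1]`: the profile of `D` or `H` at a fixed time. -/
structure IsDirichletProfile (D u w : ℝ → ℝ) : Prop where
  cont : ContinuousOn D (Icc (-1) 1)
  cont_deriv : ContinuousOn u (Icc (-1) 1)
  cont_deriv2 : ContinuousOn w (Icc (-1) 1)
  hasDerivAt : ∀ x ∈ Ioo (-1 : ℝ) 1, HasDerivAt D (u x) x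
  hasDerivAt_deriv : ∀ x ∈ Ioo (-1 : ℝ) 1, HasDerivAt u (w x) x
  left : D (-1) = 0
  right : D 1 = 0

theorem IsDirichletProfile.integral_sq_le {D u w : ℝ → ℝ} (hD : IsDirichletProfile D u w) :
    ∫ x in (-1 : ℝ)..1, D x ^ 2 ≤ 4 * ∫ x in (-1 : ℝ)..1, u x ^ 2 := by
  have h := integral_sq_primitive_le (by norm_num) (memLp_two_of_continuousOn hD.cont_deriv)
  have hprim : ∀ x ∈ uIcc (-1 : ℝ) 1, (∫ s in (-1)..x, u s) ^ 2 = D x ^ 2 := fun x hx => by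
    rw [uIcc_of_le (by norm_num)] at hx
    rw [intervalIntegral.integral_eq_sub_of_hasDerivAt_of_le hx.1
      (hD.cont.mono (Icc_subset_Icc_right hx.2))
      (fun y hy => hD.hasDerivAt y ⟨hy.1, hy.2.trans_le hx.2⟩)
      (intervalIntegrable_of_mem_Icc (intervalIntegrable_of_continuousOn hD.cont_deriv) hx),
      hD.left, sub_zero]
  rw [intervalIntegral.integral_congr hprim] at h
  norm_num at h
  exact h

section Dissipation

variable {ε γ m₀ φb : ℝ} {ψ D H u v w z : ℝ → ℝ}

/- The integrand and its asserted value differ by the derivative of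
`D u + H v - (D - k) H ψ_x`, which vanishes at `±1`. -/
theorem IsBoundaryLayer.integral_production_eq (h : IsBoundaryLayer ε γ m₀ φb ψ) (hε : ε ≠ 0)
    (hD : IsDirichletProfile D u w) (hH : IsDirichletProfile H v z) (k : ℝ) :
    ∫ x in (-1 : ℝ)..1,
        (D x * (w x - etaSteady m₀ ψ x * ((D x - k) / ε) - v x * dx ψ x)
          + H x * (z x - deltaSteady m₀ ψ x * ((D x - k) / ε) - u x * dx ψ x))
      = -∫ x in (-1 : ℝ)..1, (u x ^ 2 + v x ^ 2 + k * (v x * dx ψ x)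
          + etaSteady m₀ ψ x * (D x * (D x - k)) / ε) := by
  have hcont := h.continuousOn_dx
  have hcontη := continuousOn_etaSteady (m₀ := m₀) h.continuousOn
  have hcontδ := continuousOn_deltaSteady (m₀ := m₀) h.continuousOn
  obtain ⟨hcD, hcu, hcw, hdD, hdu, hD₀, hD₁⟩ := hD
  obtain ⟨hcH, hcv, hcz, hdH, hdv, hH₀, hH₁⟩ := hH
  rw [eq_neg_iff_add_eq_zero, ← intervalIntegral.integral_add
    (intervalIntegrable_of_continuousOn (by fun_prop))
    (intervalIntegrable_of_continuousOn (by fun_prop))]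
  rw [intervalIntegral.integral_eq_sub_of_hasDerivAt_of_le (by norm_num)
    (f := fun x => D x * u x + H x * v x - (D x - k) * H x * dx ψ x) (by fun_prop) ?_
    (intervalIntegrable_of_continuousOn (by fun_prop))]
  · simp [hD₀, hD₁, hH₀, hH₁]
  · intro x hx
    exact ((((hdD x hx).mul (hdu x hx)).add ((hdH x hx).mul (hdv x hx))).sub
      ((((hdD x hx).sub_const k).mul (hdH x hx)).mul (h.hasDerivAt_dx hε hx))).congr_deriv
        (by simp only [Pi.mul_apply]; ring)

theorem dissipation_density_ge {ε κ e k s D u v : ℝ} (hε : 0 < ε) (hκ : κ ≤ e)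
    (he : e ≤ κ + ε / 2 * s ^ 2) :
    u ^ 2 + 1 / 2 * v ^ 2 - 5 / 8 * k ^ 2 * s ^ 2 + κ / ε * (D * (D - k))
      ≤ u ^ 2 + v ^ 2 + k * (v * s) + e * (D * (D - k)) / ε := by
  have hcross : -(1 / 2 * v ^ 2 + 1 / 2 * k ^ 2 * s ^ 2) ≤ k * (v * s) := by
    linarith [sq_nonneg (v + k * s)]
  have hexcess : -(1 / 8 * k ^ 2 * s ^ 2) ≤ (e - κ) * (D * (D - k)) / ε := by
    rw [le_div_iff₀ hε]
    have hmin : -(k ^ 2 / 4) ≤ D * (D - k) := by linarith [sq_nonneg (D - k / 2)]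
    linarith [mul_le_mul_of_nonneg_left hmin (sub_nonneg.2 hκ),
      mul_le_mul_of_nonneg_left he (by positivity : 0 ≤ k ^ 2 / 4)]
  have hsplit : e * (D * (D - k)) / ε
      = κ / ε * (D * (D - k)) + (e - κ) * (D * (D - k)) / ε := by ring
  linarith

theorem mul_sq_le_integral_mul_sub (hD : ContinuousOn D (Icc (-1) 1)) {k : ℝ}
    (hk : mean D = (1 + γ) * k) :
    2 * γ * (1 + γ) * k ^ 2 ≤ ∫ x in (-1 : ℝ)..1, D x * (D x - k) := by
  have hsq := intervalIntegrable_of_continuousOn (hD.fun_pow 2)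
  have hlin := (intervalIntegrable_of_continuousOn hD).const_mul k
  calc 2 * γ * (1 + γ) * k ^ 2 = 2 * mean D ^ 2 - k * (2 * mean D) := by rw [hk]; ring
    _ ≤ (∫ x in (-1 : ℝ)..1, D x ^ 2) - k * ∫ x in (-1 : ℝ)..1, D x := by
        rw [integral_eq_two_mul_mean D]; linarith [two_mul_sq_mean_le hD]
    _ = ∫ x in (-1 : ℝ)..1, D x * (D x - k) := by
        rw [← intervalIntegral.integral_const_mul, ← intervalIntegral.integral_sub hsq hlin]
        congr with x
        ring

theorem IsBoundaryLayer.mul_integral_sq_dx_le (h : IsBoundaryLayer ε γ m₀ φb ψ) (hm : 0 < m₀)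
    (hε : 0 < ε) (hγ : 0 < γ) (hsmall : 5 * ε * φb ^ 2 ≤ 64 * constM m₀ φb ^ 2 * γ ^ 2 * (1 + γ))
    {κ : ℝ} (hκ : 2 * constM m₀ φb ^ 2 ≤ κ) :
    5 / 8 * ∫ x in (-1 : ℝ)..1, dx ψ x ^ 2 ≤ κ / ε * (2 * γ * (1 + γ)) := by
  calc 5 / 8 * ∫ x in (-1 : ℝ)..1, dx ψ x ^ 2 ≤ 5 / 8 * (φb ^ 2 / (2 * γ)) := by
        gcongr; exact h.integral_sq_dx_le hm hε hγ
    _ ≤ 2 * constM m₀ φb ^ 2 / ε * (2 * γ * (1 + γ)) := by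
        field_simp
        linarith
    _ ≤ κ / ε * (2 * γ * (1 + γ)) := by gcongr

theorem IsBoundaryLayer.integral_dissipation_ge (h : IsBoundaryLayer ε γ m₀ φb ψ) (hm : 0 < m₀)
    (hφ : 0 ≤ φb) (hε : 0 < ε) (hγ : 0 < γ)
    (hsmall : 5 * ε * φb ^ 2 ≤ 64 * constM m₀ φb ^ 2 * γ ^ 2 * (1 + γ))
    (hD : ContinuousOn D (Icc (-1) 1)) (hu : ContinuousOn u (Icc (-1) 1))
    (hv : ContinuousOn v (Icc (-1) 1)) {k : ℝ} (hk : mean D = (1 + γ) * k) :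
    (∫ x in (-1 : ℝ)..1, u x ^ 2) + 1 / 2 * ∫ x in (-1 : ℝ)..1, v x ^ 2
      ≤ ∫ x in (-1 : ℝ)..1, (u x ^ 2 + v x ^ 2 + k * (v x * dx ψ x)
          + etaSteady m₀ ψ x * (D x * (D x - k)) / ε) := by
  obtain ⟨κ, hκM, hκ⟩ := h.exists_etaSteady_bounds hm hφ hε hγ
  have hκ₀ : 0 ≤ κ := le_trans (by positivity) hκM
  have hcont := h.continuousOn_dx
  have hcontη := continuousOn_etaSteady (m₀ := m₀) h.continuousOn
  have hfield : 0 ≤ κ / ε * (∫ x in (-1 : ℝ)..1, D x * (D x - k))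
      - 5 / 8 * k ^ 2 * ∫ x in (-1 : ℝ)..1, dx ψ x ^ 2 := by
    have hlow := mul_le_mul_of_nonneg_left (mul_sq_le_integral_mul_sub hD hk)
      (div_nonneg hκ₀ hε.le)
    linarith [mul_le_mul_of_nonneg_right (h.mul_integral_sq_dx_le hm hε hγ hsmall hκM)
      (sq_nonneg k)]
  have iu := intervalIntegrable_of_continuousOn (hu.fun_pow 2)
  have iv := (intervalIntegrable_of_continuousOn (hv.fun_pow 2)).const_mul (1 / 2)
  have iψ := (intervalIntegrable_of_continuousOn (hcont.fun_pow 2)).const_mul (5 / 8 * k ^ 2)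
  have iD := (intervalIntegrable_of_continuousOn
    (hD.fun_mul (hD.fun_sub (continuousOn_const (c := k))))).const_mul (κ / ε)
  calc (∫ x in (-1 : ℝ)..1, u x ^ 2) + 1 / 2 * ∫ x in (-1 : ℝ)..1, v x ^ 2
      ≤ ∫ x in (-1 : ℝ)..1, (u x ^ 2 + 1 / 2 * v x ^ 2 - 5 / 8 * k ^ 2 * dx ψ x ^ 2
          + κ / ε * (D x * (D x - k))) := by
        rw [intervalIntegral.integral_add ((iu.add iv).sub iψ) iD,
          intervalIntegral.integral_sub (iu.add iv) iψ, intervalIntegral.integral_add iu iv]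
        simp only [intervalIntegral.integral_const_mul]
        linarith
    _ ≤ _ := intervalIntegral.integral_mono_on (by norm_num)
        (intervalIntegrable_of_continuousOn (by fun_prop))
        (intervalIntegrable_of_continuousOn (by fun_prop))
        fun x hx => dissipation_density_ge hε (hκ x hx).1 (hκ x hx).2

theorem IsBoundaryLayer.integral_production_le (h : IsBoundaryLayer ε γ m₀ φb ψ) (hm : 0 < m₀)
    (hφ : 0 ≤ φb) (hε : 0 < ε) (hγ : 0 < γ)
    (hsmall : 5 * ε * φb ^ 2 ≤ 64 * constM m₀ φb ^ 2 * γ ^ 2 * (1 + γ))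
    (hD : IsDirichletProfile D u w) (hH : IsDirichletProfile H v z)
    {k : ℝ} (hk : mean D = (1 + γ) * k) :
    ∫ x in (-1 : ℝ)..1,
        (D x * (w x - etaSteady m₀ ψ x * ((D x - k) / ε) - v x * dx ψ x)
          + H x * (z x - deltaSteady m₀ ψ x * ((D x - k) / ε) - u x * dx ψ x))
      ≤ -(1 / 4) * (1 / 2 * ((∫ x in (-1 : ℝ)..1, D x ^ 2) + ∫ x in (-1 : ℝ)..1, H x ^ 2)) := by
  rw [h.integral_production_eq hε.ne' hD hH]
  have hdiss := h.integral_dissipation_ge hm hφ hε hγ hsmall hD.cont hD.cont_deriv hH.cont_deriv hk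
  have hD₀ : 0 ≤ ∫ x in (-1 : ℝ)..1, D x ^ 2 :=
    intervalIntegral.integral_nonneg (by norm_num) fun x _ => sq_nonneg _
  linarith [hD.integral_sq_le, hH.integral_sq_le]

end Dissipation

/-- The flux `u_x - ρ φ_x - v ψ_x` of the density `u`; the linearized problem reads `u_t = F_x`
with `F` this flux, for `(u, v, ρ) = (δ, η, η⁰)` and for `(u, v, ρ) = (η, δ, δ⁰)`. -/
noncomputable def flux (ρ ψ : ℝ → ℝ) (u v φ : ℝ → ℝ → ℝ) (t x : ℝ) : ℝ :=
  dx (u t) x - ρ x * dx (φ t) x - v t x * dx ψ x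

section Flux

variable {ρ ψ : ℝ → ℝ} {u v φ : ℝ → ℝ → ℝ}

theorem continuousOn_flux (hu : IsParabolicRegular u) (hv : IsParabolicRegular v)
    (hρ : ContinuousOn ρ (Icc (-1) 1)) (hψ : ContinuousOn (dx ψ) (Icc (-1) 1))
    (hφ : ContinuousOn (fun q : ℝ × ℝ => dx (φ q.1) q.2) (Ioi 0 ×ˢ Icc (-1) 1)) :
    ContinuousOn (fun q : ℝ × ℝ => flux ρ ψ u v φ q.1 q.2) (Ioi 0 ×ˢ Icc (-1) 1) := by
  have hsnd : MapsTo (Prod.snd : ℝ × ℝ → ℝ) (Ioi 0 ×ˢ Icc (-1) 1) (Icc (-1) 1) :=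
    fun q hq => hq.2
  exact (hu.cont_x.sub ((hρ.comp continuousOn_snd hsnd).mul hφ)).sub
    (hv.cont.mul (hψ.comp continuousOn_snd hsnd))

theorem hasDerivAt_flux {t x : ℝ} (hx : x ∈ Ioo (-1 : ℝ) 1)
    (hu : DifferentiableOn ℝ (dx (u t)) (Ioo (-1) 1)) (hv : DifferentiableAt ℝ (v t) x)
    (hρ : DifferentiableAt ℝ ρ x) (hψ : IsC1C2 ψ) (hφ : IsC1C2 (φ t)) :
    HasDerivAt (flux ρ ψ u v φ t)
      (dx (dx (u t)) x - dx (fun y => ρ y * dx (φ t) y) x - dx (fun y => v t y * dx ψ y) x) x := by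
  have hρφ := hρ.hasDerivAt.fun_mul (hφ.hasDerivAt_dx hx)
  have hvψ := hv.hasDerivAt.fun_mul (hψ.hasDerivAt_dx hx)
  rw [dx_eq_of_hasDerivAt hx hρφ, dx_eq_of_hasDerivAt hx hvψ]
  exact ((hasDerivAt_dx hu hx).sub hρφ).sub hvψ

end Flux

theorem IsParabolicRegular.hasDerivAt {u : ℝ → ℝ → ℝ} {t x : ℝ} (hu : IsParabolicRegular u)
    (ht : 0 < t) (hx : x ∈ Ioo (-1 : ℝ) 1) : HasDerivAt (u t) (dx (u t) x) x :=
  hasDerivAt_dx ((hu.diff_x t ht).mono Ioo_subset_Icc_self) hx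

theorem IsNoFluxEvolution.isDirichletProfile {u F : ℝ → ℝ → ℝ} {t : ℝ}
    (h : IsNoFluxEvolution u F) (hu₀ : ∫ x in (-1 : ℝ)..1, u 0 x = 0) (ht : 0 < t) :
    IsDirichletProfile (prim u t) (u t) (dx (u t)) where
  cont := h.continuousOn_prim ht.le
  cont_deriv := continuousOn_slice h.regular.cont ht
  cont_deriv2 := continuousOn_slice (f := fun t => dx (u t)) h.regular.cont_x ht
  hasDerivAt _ hx := hasDerivAt_primitive (continuousOn_slice h.regular.cont ht) hx
  hasDerivAt_deriv _ hx := h.regular.hasDerivAt ht hx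
  left := intervalIntegral.integral_same
  right := (h.integral_eq ht).trans hu₀

namespace IsLinearizedSolution

variable {ε γ m₀ t x : ℝ} {ψ : ℝ → ℝ} {δ η φ : ℝ → ℝ → ℝ}

theorem mul_dx_phi_eq (h : IsLinearizedSolution ε γ m₀ ψ δ η φ) (ht : 0 < t)
    (hx : x ∈ Icc (-1 : ℝ) 1) : ε * dx (φ t) x = prim δ t x + ε * dx (φ t) (-1) := by
  have hδ := continuousOn_slice h.regular_delta.cont ht
  have hconst := eq_left_of_hasDerivAt_zero (f := fun x => ε * dx (φ t) x - prim δ t x)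
    ((continuousOn_const.mul (h.regular_phi t ht).continuousOn_dx).sub
      (continuousOn_primitive (by norm_num) (hδ.intervalIntegrable_of_Icc (by norm_num))))
    (fun y hy => ((((h.regular_phi t ht).hasDerivAt_dx hy).const_mul ε).sub
      (hasDerivAt_primitive hδ hy)).congr_deriv (sub_eq_zero.2 (h.eq_phi t ht y hy))) hx
  simp only [prim, intervalIntegral.integral_same, sub_zero] at hconst ⊢
  linarith

theorem mul_dx_phi_left_eq (h : IsLinearizedSolution ε γ m₀ ψ δ η φ) (ht : 0 < t) :
    (1 + γ) * (ε * dx (φ t) (-1)) = -(mean (prim δ t) + γ / 2 * prim δ t 1) := by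
  have hφ := h.regular_phi t ht
  have hprim : ContinuousOn (prim δ t) (Icc (-1) 1) := continuousOn_primitive (by norm_num)
    (intervalIntegrable_of_continuousOn (continuousOn_slice h.regular_delta.cont ht))
  have hdrop : ε * (φ t 1 - φ t (-1)) = 2 * mean (prim δ t) + 2 * (ε * dx (φ t) (-1)) := by
    rw [← intervalIntegral.integral_eq_sub_of_hasDerivAt_of_le (by norm_num) hφ.continuousOn
      (fun x hx => hφ.hasDerivAt hx) (intervalIntegrable_of_continuousOn hφ.continuousOn_dx),
      ← intervalIntegral.integral_const_mul, ← integral_eq_two_mul_mean]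
    calc ∫ x in (-1 : ℝ)..1, ε * dx (φ t) x
        = ∫ x in (-1 : ℝ)..1, (prim δ t x + ε * dx (φ t) (-1)) :=
          intervalIntegral.integral_congr fun x hx =>
            h.mul_dx_phi_eq ht (uIcc_of_le (by norm_num : (-1 : ℝ) ≤ 1) ▸ hx)
      _ = _ := by
          rw [intervalIntegral.integral_add (intervalIntegrable_of_continuousOn hprim)
            intervalIntegrable_const, intervalIntegral.integral_const]
          norm_num
  have hright : φ t 1 = -γ * dx (φ t) 1 := by linarith [h.robin_right t ht]
  have hleft : φ t (-1) = γ * dx (φ t) (-1) := by linarith [h.robin_left t ht]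
  rw [hright, hleft] at hdrop
  linear_combination (-1 / 2) * hdrop
    - γ / 2 * h.mul_dx_phi_eq ht (right_mem_Icc.2 (by norm_num))

theorem continuousOn_dx_phi (h : IsLinearizedSolution ε γ m₀ ψ δ η φ) (hε : ε ≠ 0)
    (hγ : 1 + γ ≠ 0) :
    ContinuousOn (fun q : ℝ × ℝ => dx (φ q.1) q.2) (Ioi 0 ×ˢ Icc (-1) 1) := by
  have hprim : ContinuousOn (fun q : ℝ × ℝ => prim δ q.1 q.2) (Ioi 0 ×ˢ Icc (-1) 1) :=
    continuousOn_parametric_primitive (by norm_num) h.regular_delta.cont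
  have hpair : ContinuousOn (fun q : ℝ × ℝ => (q.1, (1 : ℝ))) (Ioi 0 ×ˢ Icc (-1) 1) := by fun_prop
  have hmaps : MapsTo (fun q : ℝ × ℝ => (q.1, (1 : ℝ))) (Ioi 0 ×ˢ Icc (-1) 1)
      (Ioi 0 ×ˢ Icc (-1) 1) := fun q hq => ⟨hq.1, right_mem_Icc.2 (by norm_num)⟩
  have hmean : ContinuousOn (fun q : ℝ × ℝ => mean (prim δ q.1)) (Ioi 0 ×ˢ Icc (-1) 1) :=
    continuousOn_const.mul
      ((continuousOn_parametric_primitive (by norm_num) hprim).comp hpair hmaps)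
  have hfield : ContinuousOn (fun q : ℝ × ℝ =>
      (prim δ q.1 q.2 - (mean (prim δ q.1) + γ / 2 * prim δ q.1 1) / (1 + γ)) / ε)
      (Ioi 0 ×ˢ Icc (-1) 1) :=
    (hprim.sub ((hmean.add
      (continuousOn_const.mul (hprim.comp hpair hmaps))).div_const _)).div_const _
  refine hfield.congr fun q hq => ?_
  rw [eq_div_iff hε, mul_comm, h.mul_dx_phi_eq hq.1 hq.2, eq_sub_iff_add_eq, add_assoc,
    add_eq_left, ← mul_right_inj' hγ, mul_add, h.mul_dx_phi_left_eq hq.1]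
  field_simp
  ring

theorem isNoFluxEvolution_delta (h : IsLinearizedSolution ε γ m₀ ψ δ η φ) (hψ : IsC1C2 ψ)
    (hε : ε ≠ 0) (hγ : 1 + γ ≠ 0) :
    IsNoFluxEvolution δ (flux (etaSteady m₀ ψ) ψ δ η φ) where
  regular := h.regular_delta
  initial := h.initial_delta
  cont_flux := continuousOn_flux h.regular_delta h.regular_eta
    (continuousOn_etaSteady hψ.continuousOn) hψ.continuousOn_dx (h.continuousOn_dx_phi hε hγ)
  hasDerivAt_flux t ht x hx := h.eq_delta t ht x hx ▸ hasDerivAt_flux hx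
    (h.regular_delta.diff_xx t ht) (h.regular_eta.hasDerivAt ht hx).differentiableAt
    (hasDerivAt_etaSteady (hψ.hasDerivAt hx)).differentiableAt hψ (h.regular_phi t ht)
  flux_left t ht := h.noflux_delta t ht (-1) (by simp)
  flux_right t ht := h.noflux_delta t ht 1 (by simp)

theorem isNoFluxEvolution_eta (h : IsLinearizedSolution ε γ m₀ ψ δ η φ) (hψ : IsC1C2 ψ)
    (hε : ε ≠ 0) (hγ : 1 + γ ≠ 0) :
    IsNoFluxEvolution η (flux (deltaSteady m₀ ψ) ψ η δ φ) where
  regular := h.regular_eta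
  initial := h.initial_eta
  cont_flux := continuousOn_flux h.regular_eta h.regular_delta
    (continuousOn_deltaSteady hψ.continuousOn) hψ.continuousOn_dx (h.continuousOn_dx_phi hε hγ)
  hasDerivAt_flux t ht x hx := h.eq_eta t ht x hx ▸ hasDerivAt_flux hx
    (h.regular_eta.diff_xx t ht) (h.regular_delta.hasDerivAt ht hx).differentiableAt
    (hasDerivAt_deltaSteady (hψ.hasDerivAt hx)).differentiableAt hψ (h.regular_phi t ht)
  flux_left t ht := h.noflux_eta t ht (-1) (by simp)
  flux_right t ht := h.noflux_eta t ht 1 (by simp)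

end IsLinearizedSolution

section EnergyDerivative

variable {δ η F G : ℝ → ℝ → ℝ} {t : ℝ}

theorem hasDerivAt_energy (hδ : IsNoFluxEvolution δ F) (hη : IsNoFluxEvolution η G) (ht : 0 < t) :
    HasDerivAt (energy δ η) (∫ x in (-1 : ℝ)..1, (prim δ t x * F t x + prim η t x * G t x)) t := by
  have hflux : ∀ {u K : ℝ → ℝ → ℝ}, IsNoFluxEvolution u K →
      IntervalIntegrable (fun x => prim u t x * K t x) volume (-1) 1 := fun hu =>
    intervalIntegrable_of_continuousOn
      ((hu.continuousOn_prim ht.le).mul (continuousOn_slice hu.cont_flux ht))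
  rw [intervalIntegral.integral_add (hflux hδ) (hflux hη)]
  refine ((((hδ.hasDerivAt_integral_sq_prim ht).add
    (hη.hasDerivAt_integral_sq_prim ht)).const_mul (1 / 2)).congr_of_eventuallyEq ?_).congr_deriv
      (by ring)
  filter_upwards [lt_mem_nhds ht] with s hs
  exact energy_eq (hδ.continuousOn_prim hs.le) (hη.continuousOn_prim hs.le)

theorem tendsto_energy (hδ : IsNoFluxEvolution δ F) (hη : IsNoFluxEvolution η G) :
    Tendsto (energy δ η) (𝓝[>] 0) (𝓝 (energy δ η 0)) := by
  rw [energy_eq (hδ.continuousOn_prim le_rfl) (hη.continuousOn_prim le_rfl)]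
  refine ((hδ.tendsto_integral_sq_prim.add hη.tendsto_integral_sq_prim).const_mul (1 / 2)).congr' ?_
  filter_upwards [self_mem_nhdsWithin] with s hs
  exact (energy_eq (hδ.continuousOn_prim (le_of_lt hs)) (hη.continuousOn_prim (le_of_lt hs))).symm

end EnergyDerivative

theorem IsLinearizedSolution.energy_le {ε γ m₀ φb t : ℝ} {ψ : ℝ → ℝ} {δ η φ : ℝ → ℝ → ℝ}
    (h : IsLinearizedSolution ε γ m₀ ψ δ η φ) (hψ : IsBoundaryLayer ε γ m₀ φb ψ) (hm : 0 < m₀)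
    (hφ : 0 ≤ φb) (hε : 0 < ε) (hγ : 0 < γ)
    (hsmall : 5 * ε * φb ^ 2 ≤ 64 * constM m₀ φb ^ 2 * γ ^ 2 * (1 + γ))
    (hδ₀ : ∫ x in (-1 : ℝ)..1, δ 0 x = 0) (hη₀ : ∫ x in (-1 : ℝ)..1, η 0 x = 0) (ht : 0 < t) :
    energy δ η t ≤ energy δ η 0 * Real.exp (-(1 / 4) * t) := by
  have hγ₁ : 1 + γ ≠ 0 := by positivity
  have hδ := h.isNoFluxEvolution_delta hψ.regular hε.ne' hγ₁
  have hη := h.isNoFluxEvolution_eta hψ.regular hε.ne' hγ₁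
  refine le_mul_exp_of_hasDerivAt_le (fun t ht => hasDerivAt_energy hδ hη ht) (fun t ht => ?_)
    (tendsto_energy hδ hη) ht
  have hD := hδ.isDirichletProfile hδ₀ ht
  have hH := hη.isDirichletProfile hη₀ ht
  have hfield : ∀ x ∈ Icc (-1 : ℝ) 1,
      dx (φ t) x = (prim δ t x - -(ε * dx (φ t) (-1))) / ε := fun x hx => by
    rw [eq_div_iff hε.ne', mul_comm, h.mul_dx_phi_eq ht hx, sub_neg_eq_add]
  have hk : mean (prim δ t) = (1 + γ) * -(ε * dx (φ t) (-1)) := by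
    rw [mul_neg, h.mul_dx_phi_left_eq ht, hD.right, mul_zero, add_zero, neg_neg]
  rw [energy_eq hD.cont hH.cont]
  refine le_trans (le_of_eq (intervalIntegral.integral_congr fun x hx => ?_))
    (hψ.integral_production_le hm hφ hε hγ hsmall hD hH hk)
  rw [uIcc_of_le (by norm_num)] at hx
  simp only [flux, hfield x hx]

/-! ### The dual norm of `H¹` -/

section TestFunctions

/-- Smooth functions with compact support in `(a, b)`: the functions against which weak derivatives
on `(a, b)` are tested, bundled so that they form a vector space. -/
abbrev TestFunctionIoo (a b : ℝ) : Type := TestFunction ⟨Ioo a b, isOpen_Ioo⟩ ℝ ⊤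

variable {a b : ℝ}

theorem testFunction_left (ζ : TestFunctionIoo a b) : ζ a = 0 :=
  image_eq_zero_of_notMem_tsupport fun h => lt_irrefl a (ζ.tsupport_subset h).1

theorem testFunction_right (ζ : TestFunctionIoo a b) : ζ b = 0 :=
  image_eq_zero_of_notMem_tsupport fun h => lt_irrefl b (ζ.tsupport_subset h).2

theorem integral_deriv_testFunction (ζ : TestFunctionIoo a b) (x : ℝ) :
    ∫ s in a..x, deriv ζ s = ζ x := by
  rw [intervalIntegral.integral_deriv_eq_sub
    (fun x _ => (ζ.contDiff.differentiable (by simp)).differentiableAt)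
    ((ζ.contDiff.continuous_deriv (by simp)).intervalIntegrable _ _), testFunction_left, sub_zero]

theorem integral_testFunction_mul (ζ : TestFunctionIoo a b) (g : ℝ → ℝ) :
    ∫ x in a..b, ζ x * g x = ∫ x, ζ x * g x :=
  intervalIntegral.integral_eq_integral_of_support_subset fun _ hx =>
    Ioo_subset_Ioc_self (ζ.tsupport_subset (subset_tsupport _ (left_ne_zero_of_mul hx)))

theorem exists_testFunction_integral_eq_one (hab : a < b) :
    ∃ χ : TestFunctionIoo a b, ∫ x in a..b, χ x = 1 := by
  let bump : ContDiffBump ((a + b) / 2) :=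
    ⟨(b - a) / 8, (b - a) / 4, by linarith, by linarith⟩
  have hsub : tsupport (bump.normed volume) ⊆ Ioo a b := by
    rw [bump.tsupport_normed_eq, Real.closedBall_eq_Icc]
    exact Icc_subset_Ioo (by simp only [bump]; linarith) (by simp only [bump]; linarith)
  refine ⟨⟨bump.normed volume, bump.contDiff_normed, bump.hasCompactSupport_normed, hsub⟩, ?_⟩
  rw [← bump.integral_normed (μ := volume)]
  exact intervalIntegral.integral_eq_integral_of_support_subset
    ((subset_tsupport _).trans (hsub.trans Ioo_subset_Ioc_self))

theorem exists_subset_Icc_of_isCompact {K : Set ℝ} (hab : a < b) (hK : IsCompact K)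
    (hsub : K ⊆ Ioo a b) : ∃ l u, a < l ∧ u < b ∧ K ⊆ Icc l u := by
  rcases K.eq_empty_or_nonempty with rfl | hne
  · exact ⟨b, a, hab, hab, empty_subset _⟩
  · exact ⟨sInf K, sSup K, (hsub (hK.sInf_mem hne)).1, (hsub (hK.sSup_mem hne)).2,
      subset_Icc_csInf_csSup hK.bddBelow hK.bddAbove⟩

theorem primitive_eq_zero_of_notMem_Icc {f : ℝ → ℝ} (hf : Continuous f) {l u : ℝ} (hl : a < l)
    (hu : u < b) (hsupp : tsupport f ⊆ Icc l u) (hzero : ∫ x in a..b, f x = 0) {x : ℝ}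
    (hx : x ∉ Icc l u) : ∫ s in a..x, f s = 0 := by
  have hf0 : ∀ s ∉ Icc l u, f s = 0 := fun s hs =>
    image_eq_zero_of_notMem_tsupport fun h => hs (hsupp h)
  rcases lt_or_ge x l with hxl | hxl
  · refine intervalIntegral.integral_zero_ae (Eventually.of_forall fun s hs => hf0 s fun h => ?_)
    exact (((uIoc_subset_uIcc hs).2.trans_lt (max_lt hl hxl)).trans_le h.1).false
  · have hxu : u < x := lt_of_not_ge fun h => hx ⟨hxl, h⟩
    rw [← intervalIntegral.integral_add_adjacent_intervals (hf.intervalIntegrable a b)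
      (hf.intervalIntegrable b x), hzero, zero_add]
    refine intervalIntegral.integral_zero_ae (Eventually.of_forall fun s hs => hf0 s fun h => ?_)
    exact (((lt_min hu hxu).trans_le (uIoc_subset_uIcc hs).1).trans_le h.2).false

theorem exists_testFunction_deriv_eq (hab : a < b) (θ : TestFunctionIoo a b)
    (hθ : ∫ x in a..b, θ x = 0) : ∃ ζ : TestFunctionIoo a b, deriv ζ = θ := by
  have hd : ∀ x, HasDerivAt (fun x => ∫ s in a..x, θ s) (θ x) x := fun x =>
    (θ.continuous.integral_hasStrictDerivAt a x).hasDerivAt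
  have hderiv : deriv (fun x => ∫ s in a..x, θ s) = θ := funext fun x => (hd x).deriv
  obtain ⟨l, u, hl, hu, hlu⟩ :=
    exists_subset_Icc_of_isCompact hab θ.hasCompactSupport.isCompact θ.tsupport_subset
  have hsupp : Function.support (fun x => ∫ s in a..x, θ s) ⊆ Icc l u := fun x hx =>
    by_contra fun h => hx (primitive_eq_zero_of_notMem_Icc θ.continuous hl hu hlu hθ h)
  have hsmooth : ContDiff ℝ (⊤ : ℕ∞) (fun x => ∫ s in a..x, θ s) :=
    contDiff_infty_iff_deriv.2 ⟨fun x => (hd x).differentiableAt, by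
      rw [hderiv]; exact θ.contDiff⟩
  exact ⟨⟨_, hsmooth,
    HasCompactSupport.of_support_subset_isCompact isCompact_Icc hsupp,
    (closure_minimal hsupp isClosed_Icc).trans (Icc_subset_Ioo hl hu)⟩, hderiv⟩

theorem ae_eq_const_of_integral_mul_deriv_eq_zero (hab : a < b) {g : ℝ → ℝ}
    (hg : IntervalIntegrable g volume a b)
    (h : ∀ ζ : TestFunctionIoo a b, ∫ x in a..b, g x * deriv ζ x = 0) :
    ∃ c, ∀ᵐ x, x ∈ Ioo a b → g x = c := by
  obtain ⟨χ, hχ⟩ := exists_testFunction_integral_eq_one hab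
  -- du Bois-Reymond: `θ - (∫ θ) χ` has integral zero, hence is the derivative of a test function.
  set c := ∫ x in a..b, g x * χ x
  have hint : ∀ θ : TestFunctionIoo a b, IntervalIntegrable θ volume a b := fun θ =>
    θ.continuous.intervalIntegrable _ _
  have hgint : ∀ θ : TestFunctionIoo a b,
      IntervalIntegrable (fun x => g x * θ x) volume a b := fun θ =>
    hg.mul_continuousOn θ.continuous.continuousOn
  have hortho : ∀ θ : TestFunctionIoo a b, ∫ x in a..b, θ x * (g x - c) = 0 := by
    intro θ
    have hθχ : ∀ x, (θ - (∫ s in a..b, θ s) • χ) x = θ x - (∫ s in a..b, θ s) * χ x := fun x => rfl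
    obtain ⟨ζ, hζ⟩ := exists_testFunction_deriv_eq hab (θ - (∫ s in a..b, θ s) • χ) (by
      simp only [hθχ]
      rw [intervalIntegral.integral_sub (hint θ) ((hint χ).const_mul _),
        intervalIntegral.integral_const_mul, hχ, mul_one, sub_self])
    calc ∫ x in a..b, θ x * (g x - c)
        = (∫ x in a..b, g x * θ x) - c * ∫ x in a..b, θ x := by
          rw [← intervalIntegral.integral_const_mul,
            ← intervalIntegral.integral_sub (hgint θ) ((hint θ).const_mul c)]
          congr with x; ring
      _ = ∫ x in a..b, g x * deriv ζ x := by
          rw [mul_comm, ← intervalIntegral.integral_const_mul,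
            ← intervalIntegral.integral_sub (hgint θ) ((hgint χ).const_mul _), hζ]
          congr with x; rw [hθχ]; ring
      _ = 0 := h ζ
  have hloc : LocallyIntegrableOn (fun x => g x - c) (Ioo a b) :=
    ((intervalIntegrable_iff_integrableOn_Ioo_of_le hab.le).1
      (hg.sub intervalIntegrable_const)).locallyIntegrableOn
  refine ⟨c, ?_⟩
  filter_upwards [isOpen_Ioo.ae_eq_zero_of_integral_contDiff_smul_eq_zero hloc
    fun θ hθ hθc hθs => (integral_testFunction_mul ⟨θ, hθ, hθc, hθs⟩ _).symm.trans
      (hortho ⟨θ, hθ, hθc, hθs⟩)] with x hx hx'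
  exact sub_eq_zero.1 (hx hx')

theorem integral_primitive_mul_deriv_testFunction {w : ℝ → ℝ}
    (hw : IntervalIntegrable w volume a b) (ζ : TestFunctionIoo a b) :
    ∫ x in a..b, (∫ s in a..x, w s) * deriv ζ x = -∫ x in a..b, w x * ζ x := by
  have h := integral_mul_primitive hw
    ((ζ.contDiff.continuous_deriv (by simp)).intervalIntegrable a b)
  simp only [integral_deriv_testFunction, testFunction_right, mul_zero, zero_sub] at h
  rw [h, neg_neg]

end TestFunctions

section SobolevSpace

theorem IsH1.exists_ae_eq {v w : ℝ → ℝ} (h : IsH1 v w) :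
    ∃ c, ∀ᵐ x, x ∈ Ioo (-1 : ℝ) 1 → v x = c + ∫ s in (-1 : ℝ)..x, w s := by
  have hv := intervalIntegrable_of_memLp_two (by norm_num) h.memLp
  have hw := intervalIntegrable_of_memLp_two (by norm_num) h.memLp_deriv
  have hW := intervalIntegrable_of_continuousOn (continuousOn_primitive (by norm_num) hw)
  obtain ⟨c, hc⟩ := ae_eq_const_of_integral_mul_deriv_eq_zero (by norm_num) (hv.sub hW)
    fun ζ : TestFunctionIoo (-1) 1 => by
      have hζ := (ζ.contDiff.continuous_deriv (by simp)).continuousOn (s := uIcc (-1) 1)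
      simp only [sub_mul]
      rw [intervalIntegral.integral_sub (hv.mul_continuousOn hζ) (hW.mul_continuousOn hζ),
        h.weak ζ ζ.contDiff ζ.hasCompactSupport ζ.tsupport_subset,
        integral_primitive_mul_deriv_testFunction hw ζ, sub_self]
  refine ⟨c, ?_⟩
  filter_upwards [hc] with x hx hx'
  exact sub_eq_iff_eq_add.1 (hx hx')

theorem isH1_const (c : ℝ) : IsH1 (fun _ => c) (fun _ => 0) where
  memLp := memLp_const c
  memLp_deriv := memLp_const 0
  weak ζ hζ hc hs := by
    let ζ' : TestFunctionIoo (-1) 1 := ⟨ζ, hζ, hc, hs⟩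
    have hint : ∫ x in (-1 : ℝ)..1, deriv ζ x = 0 :=
      (integral_deriv_testFunction ζ' 1).trans (testFunction_right ζ')
    simp only [intervalIntegral.integral_const_mul, hint, zero_mul, mul_zero,
      intervalIntegral.integral_zero, neg_zero]

theorem isH1_primitive {g : ℝ → ℝ} (hg : MemLp g 2 (volume.restrict (Ioo (-1) 1))) :
    IsH1 (fun x => ∫ s in (-1 : ℝ)..x, g s) g where
  memLp := memLp_two_of_continuousOn
    (continuousOn_primitive (by norm_num) (intervalIntegrable_of_memLp_two (by norm_num) hg))
  memLp_deriv := hg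
  weak ζ hζ hc hs := integral_primitive_mul_deriv_testFunction
    (intervalIntegrable_of_memLp_two (by norm_num) hg)
    (⟨ζ, hζ, hc, hs⟩ : TestFunctionIoo (-1) 1)

theorem IsH1.const_mul {v w : ℝ → ℝ} (h : IsH1 v w) (c : ℝ) :
    IsH1 (fun x => c * v x) (fun x => c * w x) where
  memLp := h.memLp.const_mul c
  memLp_deriv := h.memLp_deriv.const_mul c
  weak ζ hζ hc hs := by
    simp only [mul_assoc, intervalIntegral.integral_const_mul, h.weak ζ hζ hc hs, mul_neg]

end SobolevSpace

section DualNorm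

theorem l2Norm_nonneg (f : ℝ → ℝ) : 0 ≤ l2Norm f := Real.sqrt_nonneg _

theorem l2Norm_sq (f : ℝ → ℝ) : l2Norm f ^ 2 = ∫ x in (-1 : ℝ)..1, f x ^ 2 :=
  Real.sq_sqrt (intervalIntegral.integral_nonneg (by norm_num) fun _ _ => sq_nonneg _)

theorem l2Norm_const_mul_sq (c : ℝ) (f : ℝ → ℝ) :
    l2Norm (fun x => c * f x) ^ 2 = c ^ 2 * l2Norm f ^ 2 := by
  simp only [l2Norm_sq, mul_pow, intervalIntegral.integral_const_mul]

theorem abs_integral_mul_le_l2Norm {f g : ℝ → ℝ}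
    (hf : MemLp f 2 (volume.restrict (Ioo (-1) 1)))
    (hg : MemLp g 2 (volume.restrict (Ioo (-1) 1))) :
    |∫ x in (-1 : ℝ)..1, f x * g x| ≤ l2Norm f * l2Norm g := by
  refine abs_le_of_sq_le_sq ?_ (mul_nonneg (l2Norm_nonneg f) (l2Norm_nonneg g))
  rw [mul_pow, l2Norm_sq, l2Norm_sq]
  simpa only [intervalIntegral_eq_integral_Ioo (by norm_num : (-1 : ℝ) ≤ 1)] using
    sq_integral_mul_le hf hg

/-- Integrable functions on `(-1, 1)` of mean zero. The dual norm of such a function is comparable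
to the `L²` norm of its primitive. -/
structure IsMeanZero (f : ℝ → ℝ) : Prop where
  intervalIntegrable : IntervalIntegrable f volume (-1) 1
  integral_eq : ∫ x in (-1 : ℝ)..1, f x = 0

variable {f v w : ℝ → ℝ}

theorem IsH1.integral_mul_eq (h : IsH1 v w) (hf : IsMeanZero f) :
    ∫ x in (-1 : ℝ)..1, f x * v x = -∫ x in (-1 : ℝ)..1, (∫ s in (-1 : ℝ)..x, f s) * w x := by
  obtain ⟨c, hc⟩ := h.exists_ae_eq
  have hw := intervalIntegrable_of_memLp_two (by norm_num) h.memLp_deriv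
  have hfW : IntervalIntegrable (fun x => f x * ∫ s in (-1 : ℝ)..x, w s) volume (-1) 1 :=
    hf.intervalIntegrable.mul_continuousOn
      (by simpa only [uIcc_of_le (by norm_num : (-1 : ℝ) ≤ 1)] using
        continuousOn_primitive (by norm_num) hw)
  calc ∫ x in (-1 : ℝ)..1, f x * v x
      = ∫ x in (-1 : ℝ)..1, (f x * c + f x * ∫ s in (-1 : ℝ)..x, w s) := by
        simp only [intervalIntegral_eq_integral_Ioo (by norm_num : (-1 : ℝ) ≤ 1)]
        refine setIntegral_congr_ae measurableSet_Ioo ?_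
        filter_upwards [hc] with x hx hx'
        rw [hx hx', mul_add]
    _ = _ := by
        rw [intervalIntegral.integral_add (hf.intervalIntegrable.mul_const c) hfW,
          intervalIntegral.integral_mul_const, hf.integral_eq,
          integral_mul_primitive hf.intervalIntegrable hw, hf.integral_eq]
        ring

theorem IsH1.integral_mul_le (h : IsH1 v w) (hf : IsMeanZero f) :
    ∫ x in (-1 : ℝ)..1, f x * v x ≤ (l2Norm fun x => ∫ s in (-1 : ℝ)..x, f s) * l2Norm w := by
  rw [h.integral_mul_eq hf]
  exact (neg_le_abs _).trans (abs_integral_mul_le_l2Norm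
    (memLp_two_of_continuousOn (continuousOn_primitive (by norm_num) hf.intervalIntegrable))
    h.memLp_deriv)

theorem IsH1.integral_mul_le_of_norm_eq_one (h : IsH1 v w) (hf : IsMeanZero f)
    (h₁ : l2Norm v ^ 2 + l2Norm w ^ 2 = 1) :
    ∫ x in (-1 : ℝ)..1, f x * v x ≤ l2Norm fun x => ∫ s in (-1 : ℝ)..x, f s :=
  (h.integral_mul_le hf).trans (mul_le_of_le_one_right (l2Norm_nonneg _)
    ((sq_le_one_iff₀ (l2Norm_nonneg w)).1 (by linarith [sq_nonneg (l2Norm v)])))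

theorem IsMeanZero.hMinusOneNorm_le (hf : IsMeanZero f) :
    hMinusOneNorm f ≤ l2Norm fun x => ∫ s in (-1 : ℝ)..x, f s := by
  refine Real.sSup_le ?_ (l2Norm_nonneg _)
  rintro _ ⟨v, w, h, h₁, rfl⟩
  exact h.integral_mul_le_of_norm_eq_one hf h₁

theorem IsH1.integral_mul_le_hMinusOneNorm (h : IsH1 v w) (hf : IsMeanZero f)
    (hpos : 0 < l2Norm v ^ 2 + l2Norm w ^ 2) :
    ∫ x in (-1 : ℝ)..1, f x * v x
      ≤ hMinusOneNorm f * Real.sqrt (l2Norm v ^ 2 + l2Norm w ^ 2) := by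
  set c := (Real.sqrt (l2Norm v ^ 2 + l2Norm w ^ 2))⁻¹ with hc
  have hunit : l2Norm (fun x => c * v x) ^ 2 + l2Norm (fun x => c * w x) ^ 2 = 1 := by
    rw [l2Norm_const_mul_sq, l2Norm_const_mul_sq, ← mul_add, hc, inv_pow, Real.sq_sqrt hpos.le,
      inv_mul_cancel₀ hpos.ne']
  have hbdd : ∫ x in (-1 : ℝ)..1, f x * (c * v x) ≤ hMinusOneNorm f := by
    refine le_csSup ⟨l2Norm fun x => ∫ s in (-1 : ℝ)..x, f s, ?_⟩
      ⟨_, _, h.const_mul c, hunit, rfl⟩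
    rintro _ ⟨v', w', h', h₁, rfl⟩
    exact h'.integral_mul_le_of_norm_eq_one hf h₁
  simp only [mul_left_comm _ c, intervalIntegral.integral_const_mul] at hbdd
  rwa [hc, inv_mul_le_iff₀ (Real.sqrt_pos.2 hpos), mul_comm] at hbdd

theorem IsMeanZero.hMinusOneNorm_nonneg (hf : IsMeanZero f) : 0 ≤ hMinusOneNorm f := by
  have hpos : 0 < l2Norm (fun _ => 1) ^ 2 + l2Norm (fun _ => 0) ^ 2 := by
    rw [l2Norm_sq, l2Norm_sq]; norm_num
  have h := (isH1_const 1).integral_mul_le_hMinusOneNorm hf hpos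
  simp only [mul_one, hf.integral_eq] at h
  exact nonneg_of_mul_nonneg_left h (Real.sqrt_pos.2 hpos)

theorem IsMeanZero.l2Norm_primitive_le (hf : IsMeanZero f) :
    (l2Norm fun x => ∫ s in (-1 : ℝ)..x, f s) ≤ 3 * hMinusOneNorm f := by
  set P : ℝ → ℝ := fun x => ∫ s in (-1 : ℝ)..x, f s
  -- Pairing `f` with the primitive of `-P` gives `‖P‖²`, by parts.
  have hP : MemLp (fun x => -P x) 2 (volume.restrict (Ioo (-1) 1)) :=
    (memLp_two_of_continuousOn (continuousOn_primitive (by norm_num) hf.intervalIntegrable)).neg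
  have hnorm := hf.hMinusOneNorm_nonneg
  rcases (l2Norm_nonneg P).eq_or_lt with hP₀ | hP₀
  · rw [← hP₀]; positivity
  have hneg : l2Norm (fun x => -P x) = l2Norm P := by simp only [l2Norm, neg_sq]
  have hpoincare := integral_sq_primitive_le (by norm_num) hP
  rw [← l2Norm_sq, ← l2Norm_sq, hneg] at hpoincare
  have hpair := (isH1_primitive hP).integral_mul_le_hMinusOneNorm hf
    (by rw [hneg]; positivity)
  have hsq : ∫ x in (-1 : ℝ)..1, f x * ∫ s in (-1 : ℝ)..x, -P s = l2Norm P ^ 2 := by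
    rw [(isH1_primitive hP).integral_mul_eq hf, l2Norm_sq, ← intervalIntegral.integral_neg]
    congr with x; ring
  have hsqrt : Real.sqrt (l2Norm (fun x => ∫ s in (-1 : ℝ)..x, -P s) ^ 2
      + l2Norm (fun x => -P x) ^ 2) ≤ 3 * l2Norm P := by
    rw [Real.sqrt_le_left (by positivity), hneg]
    linarith [sq_nonneg (l2Norm P)]
  refine le_of_mul_le_mul_right ?_ hP₀
  calc l2Norm P * l2Norm P = ∫ x in (-1 : ℝ)..1, f x * ∫ s in (-1 : ℝ)..x, -P s := by rw [hsq, sq]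
    _ ≤ hMinusOneNorm f * (3 * l2Norm P) := hpair.trans (mul_le_mul_of_nonneg_left hsqrt hnorm)
    _ = 3 * hMinusOneNorm f * l2Norm P := by ring

end DualNorm

section Densities

variable {δ η : ℝ → ℝ → ℝ} {t : ℝ}

theorem prim_nTilde (hδ : IntervalIntegrable (δ t) volume (-1) 1)
    (hη : IntervalIntegrable (η t) volume (-1) 1) {x : ℝ} (hx : x ∈ Icc (-1 : ℝ) 1) :
    prim (nTilde δ η) t x = (prim δ t x + prim η t x) / 2 := by
  simp only [prim, nTilde]
  rw [intervalIntegral.integral_div, intervalIntegral.integral_add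
    (intervalIntegrable_of_mem_Icc hδ hx) (intervalIntegrable_of_mem_Icc hη hx)]

theorem prim_pTilde (hδ : IntervalIntegrable (δ t) volume (-1) 1)
    (hη : IntervalIntegrable (η t) volume (-1) 1) {x : ℝ} (hx : x ∈ Icc (-1 : ℝ) 1) :
    prim (pTilde δ η) t x = (prim η t x - prim δ t x) / 2 := by
  simp only [prim, pTilde]
  rw [intervalIntegral.integral_div, intervalIntegral.integral_sub
    (intervalIntegrable_of_mem_Icc hη hx) (intervalIntegrable_of_mem_Icc hδ hx)]

theorem two_mul_energy_eq (hδ : IntervalIntegrable (δ t) volume (-1) 1)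
    (hη : IntervalIntegrable (η t) volume (-1) 1) :
    2 * energy δ η t = l2Norm (prim δ t) ^ 2 + l2Norm (prim η t) ^ 2 := by
  rw [energy_eq (continuousOn_primitive (by norm_num) hδ) (continuousOn_primitive (by norm_num) hη),
    l2Norm_sq, l2Norm_sq]
  ring

theorem l2Norm_prim_tilde_sq_add (hδ : IntervalIntegrable (δ t) volume (-1) 1)
    (hη : IntervalIntegrable (η t) volume (-1) 1) :
    l2Norm (prim (nTilde δ η) t) ^ 2 + l2Norm (prim (pTilde δ η) t) ^ 2 = energy δ η t := by
  have hint : ∀ {u : ℝ → ℝ → ℝ}, IntervalIntegrable (u t) volume (-1) 1 →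
      IntervalIntegrable (fun x => prim u t x ^ 2) volume (-1) 1 := fun hu =>
    intervalIntegrable_of_continuousOn ((continuousOn_primitive (by norm_num) hu).fun_pow 2)
  have hn : IntervalIntegrable (nTilde δ η t) volume (-1) 1 := (hδ.add hη).div_const 2
  have hp : IntervalIntegrable (pTilde δ η t) volume (-1) 1 := (hη.sub hδ).div_const 2
  rw [← mul_right_inj' two_ne_zero, two_mul_energy_eq hδ hη]
  simp only [l2Norm_sq]
  rw [← intervalIntegral.integral_add (hint hn) (hint hp),
    ← intervalIntegral.integral_add (hint hδ) (hint hη), ← intervalIntegral.integral_const_mul]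
  refine intervalIntegral.integral_congr fun x hx => ?_
  rw [uIcc_of_le (by norm_num)] at hx
  simp only [prim_nTilde hδ hη hx, prim_pTilde hδ hη hx]
  ring

theorem IsMeanZero.nTilde (hδ : IsMeanZero (δ t)) (hη : IsMeanZero (η t)) :
    IsMeanZero (nTilde δ η t) where
  intervalIntegrable := (hδ.intervalIntegrable.add hη.intervalIntegrable).div_const 2
  integral_eq := (prim_nTilde hδ.intervalIntegrable hη.intervalIntegrable
    (right_mem_Icc.2 (by norm_num))).trans
      (by simp only [prim, hδ.integral_eq, hη.integral_eq, add_zero, zero_div])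

theorem IsMeanZero.pTilde (hδ : IsMeanZero (δ t)) (hη : IsMeanZero (η t)) :
    IsMeanZero (pTilde δ η t) where
  intervalIntegrable := (hη.intervalIntegrable.sub hδ.intervalIntegrable).div_const 2
  integral_eq := (prim_pTilde hδ.intervalIntegrable hη.intervalIntegrable
    (right_mem_Icc.2 (by norm_num))).trans
      (by simp only [prim, hδ.integral_eq, hη.integral_eq, sub_zero, zero_div])

theorem hMinusOneNorm_tilde_sq_add_le (hδ : IsMeanZero (δ t)) (hη : IsMeanZero (η t)) :
    hMinusOneNorm (nTilde δ η t) ^ 2 + hMinusOneNorm (pTilde δ η t) ^ 2 ≤ energy δ η t := by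
  have hn := hδ.nTilde hη
  have hp := hδ.pTilde hη
  rw [← l2Norm_prim_tilde_sq_add hδ.intervalIntegrable hη.intervalIntegrable]
  exact add_le_add (pow_le_pow_left₀ hn.hMinusOneNorm_nonneg hn.hMinusOneNorm_le 2)
    (pow_le_pow_left₀ hp.hMinusOneNorm_nonneg hp.hMinusOneNorm_le 2)

theorem hMinusOneNorm_tilde_add_le (hδ : IsMeanZero (δ t)) (hη : IsMeanZero (η t)) :
    hMinusOneNorm (nTilde δ η t) + hMinusOneNorm (pTilde δ η t)
      ≤ l2Norm (prim δ t) + l2Norm (prim η t) := by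
  have hD := l2Norm_nonneg (prim δ t)
  have hH := l2Norm_nonneg (prim η t)
  refine le_of_sq_le_sq ?_ (add_nonneg hD hH)
  calc (hMinusOneNorm (nTilde δ η t) + hMinusOneNorm (pTilde δ η t)) ^ 2
      ≤ 2 * (hMinusOneNorm (nTilde δ η t) ^ 2 + hMinusOneNorm (pTilde δ η t) ^ 2) := add_sq_le
    _ ≤ 2 * energy δ η t :=
        mul_le_mul_of_nonneg_left (hMinusOneNorm_tilde_sq_add_le hδ hη) two_pos.le
    _ = l2Norm (prim δ t) ^ 2 + l2Norm (prim η t) ^ 2 :=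
        two_mul_energy_eq hδ.intervalIntegrable hη.intervalIntegrable
    _ ≤ (l2Norm (prim δ t) + l2Norm (prim η t)) ^ 2 := by
        linarith [add_sq (l2Norm (prim δ t)) (l2Norm (prim η t)), mul_nonneg hD hH]

theorem le_hMinusOneNorm_tilde_add (hδ : IsMeanZero (δ t)) (hη : IsMeanZero (η t)) :
    1 / 6 * (l2Norm (prim δ t) + l2Norm (prim η t))
      ≤ hMinusOneNorm (nTilde δ η t) + hMinusOneNorm (pTilde δ η t) := by
  have hN := l2Norm_nonneg (prim (nTilde δ η) t)
  have hP := l2Norm_nonneg (prim (pTilde δ η) t)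
  have hle : l2Norm (prim δ t) + l2Norm (prim η t)
      ≤ 2 * (l2Norm (prim (nTilde δ η) t) + l2Norm (prim (pTilde δ η) t)) := by
    refine le_of_sq_le_sq ?_ (by positivity)
    calc (l2Norm (prim δ t) + l2Norm (prim η t)) ^ 2
        ≤ 2 * (l2Norm (prim δ t) ^ 2 + l2Norm (prim η t) ^ 2) := add_sq_le
      _ = 4 * (l2Norm (prim (nTilde δ η) t) ^ 2 + l2Norm (prim (pTilde δ η) t) ^ 2) := by
          rw [l2Norm_prim_tilde_sq_add hδ.intervalIntegrable hη.intervalIntegrable,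
            ← two_mul_energy_eq hδ.intervalIntegrable hη.intervalIntegrable]
          ring
      _ ≤ (2 * (l2Norm (prim (nTilde δ η) t) + l2Norm (prim (pTilde δ η) t))) ^ 2 := by
          linarith [mul_nonneg hN hP,
            add_sq (l2Norm (prim (nTilde δ η) t)) (l2Norm (prim (pTilde δ η) t)),
            mul_pow 2 (l2Norm (prim (nTilde δ η) t) + l2Norm (prim (pTilde δ η) t)) 2]
  have hn : l2Norm (prim (nTilde δ η) t) ≤ 3 * hMinusOneNorm (nTilde δ η t) :=
    (hδ.nTilde hη).l2Norm_primitive_le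
  have hp : l2Norm (prim (pTilde δ η) t) ≤ 3 * hMinusOneNorm (pTilde δ η t) :=
    (hδ.pTilde hη).l2Norm_primitive_le
  linarith

end Densities

theorem IsNoFluxEvolution.isMeanZero {u F : ℝ → ℝ → ℝ} (h : IsNoFluxEvolution u F)
    (hu₀ : ∫ x in (-1 : ℝ)..1, u 0 x = 0) {t : ℝ} (ht : 0 ≤ t) : IsMeanZero (u t) where
  intervalIntegrable := h.intervalIntegrable ht
  integral_eq := ht.eq_or_lt.elim (fun ht => ht ▸ hu₀) fun ht => (h.integral_eq ht).trans hu₀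

theorem small_of_lt_div_sqrt {m₀ φb γmax ε γ : ℝ} (hm : 0 < m₀) (hφ : 0 < φb) (hε : 0 < ε)
    (hγ : 0 < γ) (hγmax : γ ≤ γmax)
    (hlarge : ((1 + 2 * γmax) ^ 2 + 3) * constK φb * φb / (4 * constM m₀ φb) < γ / √ε) :
    5 * ε * φb ^ 2 ≤ 64 * constM m₀ φb ^ 2 * γ ^ 2 * (1 + γ) := by
  have hM : 0 < constM m₀ φb := Real.sqrt_pos.2 (by positivity)
  have hfour : 4 ≤ (1 + 2 * γmax) ^ 2 + 3 := by
    linarith [one_le_pow₀ (n := 2) (by linarith : 1 ≤ 1 + 2 * γmax)]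
  have hfactor : 4 * φb ≤ ((1 + 2 * γmax) ^ 2 + 3) * constK φb * φb :=
    mul_le_mul_of_nonneg_right
      (hfour.trans (le_mul_of_one_le_right (by positivity) (one_le_constK hφ))) hφ.le
  have hlinear : √ε * φb ≤ constM m₀ φb * γ := by
    rw [div_lt_div_iff₀ (by positivity) (Real.sqrt_pos.2 hε)] at hlarge
    linarith [mul_le_mul_of_nonneg_right hfactor (Real.sqrt_nonneg ε)]
  have hsq : ε * φb ^ 2 ≤ constM m₀ φb ^ 2 * γ ^ 2 := by
    simpa only [mul_pow, Real.sq_sqrt hε.le] using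
      pow_le_pow_left₀ (by positivity) hlinear 2
  calc 5 * ε * φb ^ 2 ≤ 64 * (constM m₀ φb ^ 2 * γ ^ 2) * 1 := by
        linarith [mul_nonneg (sq_nonneg (constM m₀ φb)) (sq_nonneg γ)]
    _ ≤ 64 * (constM m₀ φb ^ 2 * γ ^ 2) * (1 + γ) :=
        mul_le_mul_of_nonneg_left (by linarith) (by positivity)
    _ = 64 * constM m₀ φb ^ 2 * γ ^ 2 * (1 + γ) := by ring

end PNP

open PNP in
theorem mainTheorem2_general {m₀ φb ε γ : ℝ} {ψ : ℝ → ℝ} {δ η φ : ℝ → ℝ → ℝ} (hm : 0 < m₀)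
    (hφ : 0 ≤ φb) (hε : 0 < ε) (hγ : 0 < γ)
    (hsmall : 5 * ε * φb ^ 2 ≤ 64 * constM m₀ φb ^ 2 * γ ^ 2 * (1 + γ))
    (hψ : IsBoundaryLayer ε γ m₀ φb ψ) (h : IsLinearizedSolution ε γ m₀ ψ δ η φ)
    (hδ₀ : ∫ x in (-1 : ℝ)..1, δ 0 x = 0) (hη₀ : ∫ x in (-1 : ℝ)..1, η 0 x = 0) :
    (∀ t > 0, energy δ η t ≤ energy δ η 0 * Real.exp (-(1 / 4) * t)) ∧
    (∀ t > 0, l2Norm (prim δ t) ^ 2 + l2Norm (prim η t) ^ 2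
      ≤ 2 * energy δ η 0 * Real.exp (-(1 / 4) * t)) ∧
    (∀ t ≥ 0,
      1 / 6 * (l2Norm (prim δ t) + l2Norm (prim η t))
        ≤ hMinusOneNorm (nTilde δ η t) + hMinusOneNorm (pTilde δ η t) ∧
      hMinusOneNorm (nTilde δ η t) + hMinusOneNorm (pTilde δ η t)
        ≤ l2Norm (prim δ t) + l2Norm (prim η t)) ∧
    (∀ t > 0, hMinusOneNorm (nTilde δ η t) ^ 2 + hMinusOneNorm (pTilde δ η t) ^ 2
      ≤ energy δ η 0 * Real.exp (-(1 / 4) * t)) := by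
  have hγ₁ : 1 + γ ≠ 0 := by positivity
  have hδ : ∀ t ≥ 0, IsMeanZero (δ t) := fun t ht =>
    (h.isNoFluxEvolution_delta hψ.regular hε.ne' hγ₁).isMeanZero hδ₀ ht
  have hη : ∀ t ≥ 0, IsMeanZero (η t) := fun t ht =>
    (h.isNoFluxEvolution_eta hψ.regular hε.ne' hγ₁).isMeanZero hη₀ ht
  have hdecay : ∀ t > 0, energy δ η t ≤ energy δ η 0 * Real.exp (-(1 / 4) * t) := fun t ht =>
    h.energy_le hψ hm hφ hε hγ hsmall hδ₀ hη₀ ht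
  refine ⟨hdecay, fun t ht => ?_, fun t ht => ⟨?_, ?_⟩, fun t ht => ?_⟩
  · rw [← two_mul_energy_eq (hδ t ht.le).intervalIntegrable (hη t ht.le).intervalIntegrable,
      mul_assoc]
    exact mul_le_mul_of_nonneg_left (hdecay t ht) two_pos.le
  · exact le_hMinusOneNorm_tilde_add (hδ t ht) (hη t ht)
  · exact hMinusOneNorm_tilde_add_le (hδ t ht) (hη t ht)
  · exact (hMinusOneNorm_tilde_sq_add_le (hδ t ht.le) (hη t ht.le)).trans (hdecay t ht)

theorem mainTheorem2 :
    ∃ α C₁ C₂ : ℝ, 0 < α ∧ 0 < C₁ ∧ 0 < C₂ ∧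
      ∀ (m₀ φb γmax ε γ : ℝ), 0 < m₀ → 0 < φb → 0 < ε → 0 < γ → γ ≤ γmax →
        γ / Real.sqrt ε >
          ((1 + 2 * γmax) ^ 2 + 3) * PNP.constK φb * φb / (4 * PNP.constM m₀ φb) →
      ∀ ψ : ℝ → ℝ, PNP.IsBoundaryLayer ε γ m₀ φb ψ →
      ∀ δ η φ : ℝ → ℝ → ℝ, PNP.IsLinearizedSolution ε γ m₀ ψ δ η φ →
        (∫ x in (-1 : ℝ)..1, δ 0 x) = 0 → (∫ x in (-1 : ℝ)..1, η 0 x) = 0 →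
        (∀ t > 0,
          PNP.energy δ η t ≤ PNP.energy δ η 0 * Real.exp (-α * t)) ∧
        (∀ t > 0,
          (PNP.l2Norm (PNP.prim δ t)) ^ 2 + (PNP.l2Norm (PNP.prim η t)) ^ 2
            ≤ 2 * PNP.energy δ η 0 * Real.exp (-α * t)) ∧
        (∀ t ≥ 0,
          C₁ * (PNP.l2Norm (PNP.prim δ t) + PNP.l2Norm (PNP.prim η t))
              ≤ PNP.hMinusOneNorm (PNP.nTilde δ η t) + PNP.hMinusOneNorm (PNP.pTilde δ η t) ∧
          PNP.hMinusOneNorm (PNP.nTilde δ η t) + PNP.hMinusOneNorm (PNP.pTilde δ η t)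
              ≤ C₂ * (PNP.l2Norm (PNP.prim δ t) + PNP.l2Norm (PNP.prim η t))) ∧
        (∀ t > 0,
          (PNP.hMinusOneNorm (PNP.nTilde δ η t)) ^ 2 + (PNP.hMinusOneNorm (PNP.pTilde δ η t)) ^ 2
            ≤ PNP.energy δ η 0 * Real.exp (-α * t)) := by
  exact ⟨1 / 4, 1 / 6, 1, by norm_num, by norm_num, by norm_num,
    fun _ _ _ _ _ hm hφ hε hγ hγmax hlarge _ hψ _ _ _ h hδ₀ hη₀ => by
      simpa only [one_mul] using mainTheorem2_general hm hφ.le hε hγ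
        (PNP.small_of_lt_div_sqrt hm hφ hε hγ hγmax hlarge) hψ h hδ₀ hη₀⟩
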